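/- Let $m,n\ge 2$. Let $M_k$ be the space of $k\times k$ complex matrices, let $M_{mn}=M_m\otimes M_n$ via the Kronecker product, and let $\mathcal P_k\subset M_k$ be the set of Hermitian matrices of rank one and trace one. Put $\mathcal P_m\otimes\mathcal P_n=\{P\otimes Q: P\in\mathcal P_m,\ Q\in\mathcal P_n\}$, and for $T\in M_{mn}$ define the product numerical range $$W^{\otimes}(T)=\{\operatorname{tr}(TX): X\in\mathcal P_m\otimes\mathcal P_n\}\subset\mathbb C .$$ Let $\Psi:M_{mn}\to M_{mn}$ be a complex linear map, and let $\Psi^*$ be its dual map with respect to the inner product $\langle X,Y\rangle=\operatorname{tr}(XY^*)$, i.e. $\langle\Psi(X),Y\rangle=\langle X,\Psi^*(Y)\rangle$ for all $X,Y\in M_{mn}$. The following are equivalent. (a) $W^{\otimes}(\Psi^*(T))=W^{\otimes}(T)$ for all $T\in M_{mn}$. (b) $\operatorname{conv} W^{\otimes}(\Psi^*(T))=\operatorname{conv} W^{\otimes}(T)$ for all $T\in M_{mn}$. (c) There are unitary matrices $U\in M_m$ and $V\in M_n$, a map $\psi_1$ of the form $A\mapsto UAU^*$ or $A\mapsto UA^{T}U^*$,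 and a map $\psi_2$ of the form $B\mapsto VBV^*$ or $B\mapsto VB^{T}V^*$, such that either $\Psi(A\otimes B)=\psi_1(A)\otimes\psi_2(B)$ for all Hermitian $A\in M_m$, $B\in M_n$; or $m=n$ and $\Psi(A\otimes B)=\psi_2(B)\otimes\psi_1(A)$ for all Hermitian $A\in M_m$, $B\in M_n$. -/

import Mathlib

open scoped Matrix Kronecker ComplexConjugate

namespace ProdNumRange

/-- The set of pure states: Hermitian complex matrices of rank one and trace one. -/
def pureStates (m : ℕ) : Set (Matrix (Fin m) (Fin m) ℂ) :=
  {P | P.IsHermitian ∧ P.rank = 1 ∧ P.trace = 1}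

/-- The set of separable pure states `P ⊗ Q`. The space of `mn × mn` complex matrices is
represented by matrices indexed by `Fin m × Fin n`. -/
def sepPureStates (m n : ℕ) : Set (Matrix (Fin m × Fin n) (Fin m × Fin n) ℂ) :=
  {X | ∃ P ∈ pureStates m, ∃ Q ∈ pureStates n, X = P ⊗ₖ Q}

/-- The product numerical range `{tr (T X) : X a separable pure state}`. -/
def prodNumRange {m n : ℕ} (T : Matrix (Fin m × Fin n) (Fin m × Fin n) ℂ) : Set ℂ :=
  {z | ∃ X ∈ sepPureStates m n, z = (T * X).trace}

/-- The dual (adjoint) map of a linear map on square matrices, with respect to the inner product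
`⟨X, Y⟩ = tr (X Yᴴ)`. The formula gives its entries; `trace_dualMap` and `eq_dualMap` show that it
is the unique map with `⟨Ψ X, Y⟩ = ⟨X, Ψ* Y⟩` for all `X` and `Y`. -/
noncomputable def dualMap {ι : Type*} [Fintype ι] [DecidableEq ι]
    (Ψ : Matrix ι ι ℂ →ₗ[ℂ] Matrix ι ι ℂ) : Matrix ι ι ℂ →ₗ[ℂ] Matrix ι ι ℂ where
  toFun T := Matrix.of fun i j => (T * (Ψ (Matrix.single i j 1))ᴴ).trace
  map_add' S T := by
    ext i j
    simp [add_mul]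
  map_smul' c T := by
    ext i j
    simp

theorem trace_single_mul_conjTranspose {ι : Type*} [Fintype ι] [DecidableEq ι]
    (i j : ι) (Y : Matrix ι ι ℂ) :
    (Matrix.single i j (1 : ℂ) * Yᴴ).trace = conj (Y i j) := by
  simp [Matrix.trace_single_mul]

theorem trace_dualMap {ι : Type*} [Fintype ι] [DecidableEq ι]
    (Ψ : Matrix ι ι ℂ →ₗ[ℂ] Matrix ι ι ℂ) (X Y : Matrix ι ι ℂ) :
    (Ψ X * Yᴴ).trace = (X * (dualMap Ψ Y)ᴴ).trace := by
  induction X using Matrix.induction_on' with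
  | h_zero => simp
  | h_add p q hp hq => simp [add_mul, hp, hq]
  | h_std_basis i j x =>
    have hx : Matrix.single i j x = x • Matrix.single i j (1 : ℂ) := by simp
    rw [hx, map_smul, Matrix.smul_mul, Matrix.smul_mul, Matrix.trace_smul, Matrix.trace_smul,
      trace_single_mul_conjTranspose]
    congr 1
    change _ = star ((Y * (Ψ (Matrix.single i j 1))ᴴ).trace)
    rw [← Matrix.trace_conjTranspose, Matrix.conjTranspose_mul, Matrix.conjTranspose_conjTranspose]

theorem eq_dualMap {ι : Type*} [Fintype ι] [DecidableEq ι]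
    (Ψ : Matrix ι ι ℂ →ₗ[ℂ] Matrix ι ι ℂ) (Φ : Matrix ι ι ℂ → Matrix ι ι ℂ)
    (h : ∀ X Y, (Ψ X * Yᴴ).trace = (X * (Φ Y)ᴴ).trace) (Y : Matrix ι ι ℂ) :
    Φ Y = dualMap Ψ Y := by
  ext i j
  have := (h (Matrix.single i j 1) Y).symm.trans (trace_dualMap Ψ (Matrix.single i j 1) Y)
  rw [trace_single_mul_conjTranspose, trace_single_mul_conjTranspose] at this
  exact (starRingEnd ℂ).injective this

/-- `ψ` has the form `A ↦ U A U*` or `A ↦ U Aᵀ U*`. -/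
def IsConjForm {k : ℕ} (U : Matrix (Fin k) (Fin k) ℂ)
    (ψ : Matrix (Fin k) (Fin k) ℂ → Matrix (Fin k) (Fin k) ℂ) : Prop :=
  (∀ A, ψ A = U * A * Uᴴ) ∨ (∀ A, ψ A = U * Aᵀ * Uᴴ)

/-- There are unitary `U`, `V` and maps `ψ₁`, `ψ₂` of the form `A ↦ U A U*` or `A ↦ U Aᵀ U*`,
respectively `B ↦ V B V*` or `B ↦ V Bᵀ V*`, such that either `Ψ (A ⊗ B) = ψ₁ A ⊗ ψ₂ B` for all
Hermitian `A`, `B`, or `m = n` and `Ψ (A ⊗ B) = ψ₂ B ⊗ ψ₁ A` for all Hermitian `A`, `B`.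
The reindexing only identifies `Fin m` with `Fin n` along the equality `m = n`. -/
def HasNaturalForm {m n : ℕ}
    (Ψ : Matrix (Fin m × Fin n) (Fin m × Fin n) ℂ →ₗ[ℂ]
      Matrix (Fin m × Fin n) (Fin m × Fin n) ℂ) : Prop :=
  ∃ U ∈ Matrix.unitaryGroup (Fin m) ℂ, ∃ V ∈ Matrix.unitaryGroup (Fin n) ℂ,
  ∃ ψ₁ : Matrix (Fin m) (Fin m) ℂ → Matrix (Fin m) (Fin m) ℂ,
  ∃ ψ₂ : Matrix (Fin n) (Fin n) ℂ → Matrix (Fin n) (Fin n) ℂ,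
    IsConjForm U ψ₁ ∧ IsConjForm V ψ₂ ∧
    ((∀ (A : Matrix (Fin m) (Fin m) ℂ) (B : Matrix (Fin n) (Fin n) ℂ),
        A.IsHermitian → B.IsHermitian → Ψ (A ⊗ₖ B) = ψ₁ A ⊗ₖ ψ₂ B) ∨
      ∃ h : m = n, ∀ (A : Matrix (Fin m) (Fin m) ℂ) (B : Matrix (Fin n) (Fin n) ℂ),
        A.IsHermitian → B.IsHermitian →
          Ψ (A ⊗ₖ B) = Matrix.reindex (finCongr h.symm) (finCongr h.symm) (ψ₂ B) ⊗ₖ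
            Matrix.reindex (finCongr h) (finCongr h) (ψ₁ A))

end ProdNumRange

/-! (c) ⇒ (a): a map of the natural form permutes the separable pure states, and `tr (Ψ*(T) X) = tr
(T Ψ(X))` when `X` is such a state, so the two ranges coincide.

(b) ⇒ (c) has three stages. Separable pure states are Hermitian unit vectors for the Hilbert–Schmidt
norm. Testing (b) at `T = X₀` and at `T = Ψ X` produces the equality case of Cauchy–Schwarz, so
every such `X₀` is some `Ψ X`. These states span, hence `Ψ` is bijective; the same argument for the
inverse shows that `Ψ` permutes them (`image_sepPureStates`).

The sum of two distinct separable pure states has a second decomposition exactly when they share a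
factor (`sumAmbiguous_iff`). Linear bijections respect this, so `Ψ` induces an automorphism of the
rook's graph on pairs `(P, Q)`, which preserves or exchanges the two directions
(`exists_prod_of_collinear_iff`).

Partial traces extend the resulting factor maps linearly. A linear map taking pure states onto pure
states fixes the identity and preserves the trace form (`preservesPure_of_surjOn`), so Wigner's
theorem applies (`PreservesPure.exists_isConjForm`). In the exchanged case a trace count forces `m =
n`. -/

namespace ProdNumRange

/-! ### Pure states as unit vectors of the Hilbert–Schmidt space. -/

section Pure

variable {m : ℕ}

/-- The rank one matrix `v v*`. -/
def ketbra (v : Fin m → ℂ) : Matrix (Fin m) (Fin m) ℂ := Matrix.vecMulVec v (star v)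

theorem ketbra_apply (v : Fin m → ℂ) (i j : Fin m) : ketbra v i j = v i * conj (v j) := rfl

theorem ketbra_isHermitian (v : Fin m → ℂ) : (ketbra v).IsHermitian := by
  ext i j
  simp [ketbra_apply, mul_comm]

theorem trace_ketbra (v : Fin m → ℂ) : (ketbra v).trace = star v ⬝ᵥ v := by
  simp [ketbra, Matrix.trace_vecMulVec, dotProduct_comm]

theorem conj_mul_ketbra_mul {k : ℕ} (U : Matrix (Fin k) (Fin m) ℂ) (v : Fin m → ℂ) :
    U * ketbra v * Uᴴ = ketbra (U *ᵥ v) := by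
  rw [ketbra, ketbra, Matrix.mul_vecMulVec, Matrix.vecMulVec_mul, Matrix.star_mulVec]

theorem transpose_ketbra (v : Fin m → ℂ) : (ketbra v)ᵀ = ketbra (star v) := by
  ext i j
  simp [ketbra_apply, mul_comm]

theorem trace_mul_ketbra (A : Matrix (Fin m) (Fin m) ℂ) (v : Fin m → ℂ) :
    (A * ketbra v).trace = star v ⬝ᵥ (A *ᵥ v) := by
  rw [ketbra, Matrix.mul_vecMulVec, Matrix.trace_vecMulVec, dotProduct_comm]

theorem trace_ketbra_mul_ketbra (v w : Fin m → ℂ) :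
    (ketbra v * ketbra w).trace = (Complex.normSq (star v ⬝ᵥ w) : ℂ) := by
  rw [ketbra, ketbra, Matrix.vecMulVec_mul_vecMulVec, Matrix.vecMulVec_smul, Matrix.trace_smul, Matrix.trace_vecMulVec,
    Complex.normSq_eq_conj_mul_self, smul_eq_mul, mul_comm]
  congr 1
  simp [dotProduct, mul_comm]

theorem mul_diagonal_mul_conjTranspose (U : Matrix (Fin m) (Fin m) ℂ) (d : Fin m → ℂ) :
    U * Matrix.diagonal d * Uᴴ = ∑ i, d i • ketbra (fun a => U a i) := by
  ext a b
  simp [Matrix.mul_apply, Matrix.sum_apply, ketbra_apply, Matrix.diagonal_apply]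
  exact Finset.sum_congr rfl fun i _ => by ring

theorem ketbra_mem_pureStates {v : Fin m → ℂ} (hv : star v ⬝ᵥ v = 1) :
    ketbra v ∈ pureStates m := by
  have ht : (ketbra v).trace = 1 := by rw [trace_ketbra, hv]
  refine ⟨ketbra_isHermitian v, le_antisymm (Matrix.rank_vecMulVec_le v (star v)) ?_, ht⟩
  rw [Nat.one_le_iff_ne_zero, Ne, Matrix.rank, Submodule.finrank_eq_zero,
    LinearMap.range_eq_bot]
  intro h
  have hz : ketbra v = 0 := Matrix.ext_of_mulVec_single fun i =>
    (LinearMap.congr_fun h (Pi.single i 1)).trans (Matrix.zero_mulVec _).symm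
  rw [hz] at ht
  simp at ht

/-- Spectral decomposition of a Hermitian matrix into rank one projections. -/
theorem exists_spectral {A : Matrix (Fin m) (Fin m) ℂ} (hA : A.IsHermitian) :
    ∃ v : Fin m → Fin m → ℂ, (∀ i j, star (v i) ⬝ᵥ v j = if i = j then 1 else 0) ∧
      ∑ i, ketbra (v i) = 1 ∧ A = ∑ i, (hA.eigenvalues i : ℂ) • ketbra (v i) := by
  set U : Matrix (Fin m) (Fin m) ℂ := (hA.eigenvectorUnitary : Matrix (Fin m) (Fin m) ℂ)
  have h1 : star U * U = 1 := Unitary.coe_star_mul_self hA.eigenvectorUnitary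
  have h2 : U * star U = 1 := Unitary.coe_mul_star_self hA.eigenvectorUnitary
  refine ⟨fun i a => U a i, fun i j => ?_, ?_, ?_⟩
  · have := congrFun (congrFun h1 i) j
    simpa [Matrix.mul_apply, dotProduct, Matrix.one_apply] using this
  · have := mul_diagonal_mul_conjTranspose U 1
    rw [show (Matrix.diagonal (1 : Fin m → ℂ)) = 1 from Matrix.diagonal_one, mul_one,
      ← Matrix.star_eq_conjTranspose, h2] at this
    simpa using this.symm
  · rw [← mul_diagonal_mul_conjTranspose]
    have := hA.spectral_theorem
    simpa [Unitary.conjStarAlgAut_apply, Matrix.star_eq_conjTranspose, Function.comp_def] using this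

theorem exists_ketbra_of_mem_pureStates {P : Matrix (Fin m) (Fin m) ℂ} (hP : P ∈ pureStates m) :
    ∃ v : Fin m → ℂ, star v ⬝ᵥ v = 1 ∧ P = ketbra v := by
  obtain ⟨hH, hr, ht⟩ := hP
  obtain ⟨v, hv, -, hsum⟩ := exists_spectral hH
  rw [hH.rank_eq_card_non_zero_eigs, Fintype.card_eq_one_iff] at hr
  obtain ⟨⟨i, hi⟩, huniq⟩ := hr
  have hz : ∀ j, j ≠ i → hH.eigenvalues j = 0 := by
    intro j hj
    by_contra h
    exact hj (congrArg Subtype.val (huniq ⟨j, h⟩))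
  have hP : P = (hH.eigenvalues i : ℂ) • ketbra (v i) := by
    rw [Finset.sum_eq_single i (fun j _ hj => by simp [hz j hj]) (by simp)] at hsum
    exact hsum
  have h1 : (hH.eigenvalues i : ℂ) = 1 := by
    have hvi := hv i i
    rw [hP, Matrix.trace_smul, trace_ketbra] at ht
    simpa [hvi] using ht
  exact ⟨v i, by simpa using hv i i, by rw [h1, one_smul] at hP; exact hP⟩

theorem trace_conjTranspose_mul_self_re_nonneg {ι : Type*} [Fintype ι] (A : Matrix ι ι ℂ) :
    0 ≤ (Aᴴ * A).trace.re := by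
  simp only [Matrix.trace, Matrix.diag, Matrix.mul_apply, Matrix.conjTranspose_apply,
    Complex.re_sum]
  refine Finset.sum_nonneg fun i _ => Finset.sum_nonneg fun j _ => ?_
  rw [Complex.star_def, ← Complex.normSq_eq_conj_mul_self, Complex.ofReal_re]
  exact Complex.normSq_nonneg _

theorem eq_zero_of_trace_conjTranspose_mul_self_re {ι : Type*} [Fintype ι] {A : Matrix ι ι ℂ}
    (h : (Aᴴ * A).trace.re ≤ 0) : A = 0 := by
  open ComplexOrder in rw [← Matrix.trace_conjTranspose_mul_self_eq_zero_iff]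
  apply Complex.ext
  · exact le_antisymm h (trace_conjTranspose_mul_self_re_nonneg A)
  · have : conj (Aᴴ * A).trace = (Aᴴ * A).trace := by
      rw [← Complex.star_def, ← Matrix.trace_conjTranspose, Matrix.conjTranspose_mul,
        Matrix.conjTranspose_conjTranspose]
    exact Complex.conj_eq_iff_im.mp this

variable {P Q : Matrix (Fin m) (Fin m) ℂ}

theorem trace_mul_self_of_pure (hP : P ∈ pureStates m) : (P * P).trace = 1 := by
  obtain ⟨v, hv, rfl⟩ := exists_ketbra_of_mem_pureStates hP
  simp [trace_ketbra_mul_ketbra, hv]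

theorem trace_mul_im_of_pure (hP : P ∈ pureStates m) (hQ : Q ∈ pureStates m) :
    (P * Q).trace = ((P * Q).trace.re : ℂ) := by
  obtain ⟨v, hv, rfl⟩ := exists_ketbra_of_mem_pureStates hP
  obtain ⟨w, hw, rfl⟩ := exists_ketbra_of_mem_pureStates hQ
  simp [trace_ketbra_mul_ketbra]

theorem trace_mul_re_nonneg (hP : P ∈ pureStates m) (hQ : Q ∈ pureStates m) :
    0 ≤ (P * Q).trace.re := by
  obtain ⟨v, hv, rfl⟩ := exists_ketbra_of_mem_pureStates hP
  obtain ⟨w, hw, rfl⟩ := exists_ketbra_of_mem_pureStates hQ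
  simpa [trace_ketbra_mul_ketbra] using Complex.normSq_nonneg _

theorem trace_sub_conjTranspose_mul_sub (hP : P ∈ pureStates m) (hQ : Q ∈ pureStates m) :
    ((P - Q)ᴴ * (P - Q)).trace.re = 2 - 2 * (P * Q).trace.re := by
  rw [Matrix.conjTranspose_sub, hP.1.eq, hQ.1.eq, sub_mul, mul_sub, mul_sub, Matrix.trace_sub,
    Matrix.trace_sub, Matrix.trace_sub, Matrix.trace_mul_comm Q P, trace_mul_self_of_pure hP,
    trace_mul_self_of_pure hQ]
  simp
  ring

theorem trace_mul_re_le_one (hP : P ∈ pureStates m) (hQ : Q ∈ pureStates m) :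
    (P * Q).trace.re ≤ 1 := by
  have := trace_sub_conjTranspose_mul_sub hP hQ
  have := trace_conjTranspose_mul_self_re_nonneg (P - Q)
  linarith

/-- Equality case of Cauchy–Schwarz: `‖P - Q‖² = 2 - 2 tr (PQ)`. -/
theorem eq_of_trace_mul_re (hP : P ∈ pureStates m) (hQ : Q ∈ pureStates m)
    (h : 1 ≤ (P * Q).trace.re) : P = Q := by
  have := trace_sub_conjTranspose_mul_sub hP hQ
  exact sub_eq_zero.mp (eq_zero_of_trace_conjTranspose_mul_self_re (by linarith))

theorem transpose_mem_pureStates (hP : P ∈ pureStates m) : Pᵀ ∈ pureStates m := by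
  obtain ⟨v, hv, rfl⟩ := exists_ketbra_of_mem_pureStates hP
  rw [transpose_ketbra]
  refine ketbra_mem_pureStates ?_
  rw [star_star, dotProduct_comm, hv]

theorem conj_mem_pureStates {U : Matrix (Fin m) (Fin m) ℂ} (hU : Uᴴ * U = 1)
    (hP : P ∈ pureStates m) : U * P * Uᴴ ∈ pureStates m := by
  obtain ⟨v, hv, rfl⟩ := exists_ketbra_of_mem_pureStates hP
  rw [conj_mul_ketbra_mul]
  refine ketbra_mem_pureStates ?_
  rw [Matrix.star_mulVec, ← Matrix.dotProduct_mulVec, Matrix.mulVec_mulVec, hU, Matrix.one_mulVec,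
    hv]

/-- The pure states span the space of matrices. -/
theorem span_pureStates (m : ℕ) : Submodule.span ℂ (pureStates m) = ⊤ := by
  have herm : ∀ A : Matrix (Fin m) (Fin m) ℂ, A.IsHermitian →
      A ∈ Submodule.span ℂ (pureStates m) := by
    intro A hA
    obtain ⟨v, hv, -, hs⟩ := exists_spectral hA
    rw [hs]
    exact Submodule.sum_mem _ fun i _ => Submodule.smul_mem _ _
      (Submodule.subset_span (ketbra_mem_pureStates (by simpa using hv i i)))
  rw [eq_top_iff]
  intro A _
  have h1 : (A + Aᴴ).IsHermitian := by
    rw [Matrix.IsHermitian, Matrix.conjTranspose_add, Matrix.conjTranspose_conjTranspose, add_comm]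
  have h2 : (Complex.I • (A - Aᴴ)).IsHermitian := by
    rw [Matrix.IsHermitian, Matrix.conjTranspose_smul, Matrix.conjTranspose_sub,
      Matrix.conjTranspose_conjTranspose, Complex.star_def, Complex.conj_I, neg_smul, ← smul_neg,
      neg_sub]
  have : A = (1 / 2 : ℂ) • (A + Aᴴ) + (-Complex.I / 2) • (Complex.I • (A - Aᴴ)) := by
    rw [smul_smul, show -Complex.I / 2 * Complex.I = 1 / 2 by
      rw [div_mul_eq_mul_div, neg_mul, Complex.I_mul_I, neg_neg], ← smul_add]
    ext i j
    simp
    ring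
  rw [this]
  exact Submodule.add_mem _ (Submodule.smul_mem _ _ (herm _ h1)) (Submodule.smul_mem _ _ (herm _ h2))

theorem linearMap_ext_pure {V : Type*} [AddCommMonoid V] [Module ℂ V]
    {f g : Matrix (Fin m) (Fin m) ℂ →ₗ[ℂ] V} (h : ∀ P ∈ pureStates m, f P = g P) : f = g :=
  LinearMap.ext_on (span_pureStates m) h

/-- Three points per side feed the pigeonhole argument in `rows_parallel`. The coefficients 3/5 and
4/5 make a superposition of unit norm without square roots. -/
theorem exists_three_pureStates (hm : 2 ≤ m) :
    ∃ a b c : pureStates m, a ≠ b ∧ a ≠ c ∧ b ≠ c := by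
  let i : Fin m := ⟨0, by omega⟩
  let j : Fin m := ⟨1, by omega⟩
  have hij : i ≠ j := by simp [i, j]
  let w : Fin m → ℂ := (3 / 5 : ℂ) • Pi.single i 1 + (4 / 5 : ℂ) • Pi.single j 1
  have hi : star (Pi.single i (1 : ℂ) : Fin m → ℂ) ⬝ᵥ Pi.single i 1 = 1 := by simp
  have hj : star (Pi.single j (1 : ℂ) : Fin m → ℂ) ⬝ᵥ Pi.single j 1 = 1 := by simp
  have hw : star w ⬝ᵥ w = 1 := by
    simp [w, hij, hij.symm]
    norm_num
  refine ⟨⟨_, ketbra_mem_pureStates hi⟩, ⟨_, ketbra_mem_pureStates hj⟩,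
    ⟨_, ketbra_mem_pureStates hw⟩, ?_, ?_, ?_⟩ <;> intro h <;>
    replace h := congrFun (congrFun (congrArg Subtype.val h) i) i <;>
    (simp [ketbra_apply, w, hij, map_ofNat] at h; try norm_num at h)

end Pure

/-! ### Separable pure states and their span. -/

section Product

variable {m n : ℕ}

theorem trace_kronecker_mul_kronecker (A C : Matrix (Fin m) (Fin m) ℂ)
    (B D : Matrix (Fin n) (Fin n) ℂ) :
    ((A ⊗ₖ B) * (C ⊗ₖ D)).trace = (A * C).trace * (B * D).trace := by
  rw [← Matrix.mul_kronecker_mul, Matrix.trace_kronecker]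

theorem kronecker_mem {P : Matrix (Fin m) (Fin m) ℂ} {Q : Matrix (Fin n) (Fin n) ℂ}
    (hP : P ∈ pureStates m) (hQ : Q ∈ pureStates n) : P ⊗ₖ Q ∈ sepPureStates m n :=
  ⟨P, hP, Q, hQ, rfl⟩

theorem isHermitian_of_mem_sepPureStates {X : Matrix (Fin m × Fin n) (Fin m × Fin n) ℂ}
    (hX : X ∈ sepPureStates m n) : X.IsHermitian := by
  obtain ⟨P, hP, Q, hQ, rfl⟩ := hX
  rw [Matrix.IsHermitian, Matrix.conjTranspose_kronecker, hP.1.eq, hQ.1.eq]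

theorem trace_mul_self_of_sepPure {X : Matrix (Fin m × Fin n) (Fin m × Fin n) ℂ}
    (hX : X ∈ sepPureStates m n) : (X * X).trace = 1 := by
  obtain ⟨P, hP, Q, hQ, rfl⟩ := hX
  rw [trace_kronecker_mul_kronecker, trace_mul_self_of_pure hP, trace_mul_self_of_pure hQ, one_mul]

/-- Two overlaps in `[0, 1]` whose product is 1 are both 1. -/
theorem kronecker_inj {P P' : Matrix (Fin m) (Fin m) ℂ} {Q Q' : Matrix (Fin n) (Fin n) ℂ}
    (hP : P ∈ pureStates m) (hP' : P' ∈ pureStates m) (hQ : Q ∈ pureStates n)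
    (hQ' : Q' ∈ pureStates n) (h : P ⊗ₖ Q = P' ⊗ₖ Q') : P = P' ∧ Q = Q' := by
  have h1 := trace_mul_self_of_sepPure (kronecker_mem hP' hQ')
  nth_rw 1 [← h] at h1
  rw [trace_kronecker_mul_kronecker, trace_mul_im_of_pure hP hP', trace_mul_im_of_pure hQ hQ',
    ← Complex.ofReal_mul, Complex.ofReal_eq_one] at h1
  have a1 := trace_mul_re_nonneg hP hP'
  have a2 := trace_mul_re_nonneg hQ hQ'
  have a3 := trace_mul_re_le_one hP hP'
  have a4 := trace_mul_re_le_one hQ hQ'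
  exact ⟨eq_of_trace_mul_re hP hP' (by nlinarith), eq_of_trace_mul_re hQ hQ' (by nlinarith)⟩

theorem bilinear_ext_pure {V : Type*} [AddCommMonoid V] [Module ℂ V]
    {f g : Matrix (Fin m) (Fin m) ℂ →ₗ[ℂ] Matrix (Fin n) (Fin n) ℂ →ₗ[ℂ] V}
    (h : ∀ P ∈ pureStates m, ∀ Q ∈ pureStates n, f P Q = g P Q) : f = g :=
  linearMap_ext_pure fun P hP => linearMap_ext_pure fun Q hQ => h P hP Q hQ

/-- The Kronecker product as a bilinear map on square matrices. -/
def kron (m n : ℕ) : Matrix (Fin m) (Fin m) ℂ →ₗ[ℂ] Matrix (Fin n) (Fin n) ℂ →ₗ[ℂ]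
    Matrix (Fin m × Fin n) (Fin m × Fin n) ℂ := Matrix.kroneckerBilinear

@[simp]
theorem kron_apply (A : Matrix (Fin m) (Fin m) ℂ) (B : Matrix (Fin n) (Fin n) ℂ) :
    kron m n A B = A ⊗ₖ B := rfl

theorem span_sepPureStates (m n : ℕ) : Submodule.span ℂ (sepPureStates m n) = ⊤ := by
  set N := Submodule.span ℂ (sepPureStates m n)
  -- Modulo the span the Kronecker product is a bilinear map that vanishes on pure states, hence
  -- everywhere.
  have key : ((kron m n).compr₂ N.mkQ) = 0 :=
    bilinear_ext_pure fun P hP Q hQ => by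
      simpa using Submodule.subset_span (kronecker_mem hP hQ)
  rw [eq_top_iff]
  intro X _
  induction X using Matrix.induction_on' with
  | h_zero => exact zero_mem _
  | h_add p q hp hq => exact add_mem (hp trivial) (hq trivial)
  | h_std_basis i j x =>
    have := LinearMap.congr_fun₂ key (Matrix.single i.1 j.1 x) (Matrix.single i.2 j.2 1)
    simpa [Matrix.single_kronecker_single] using this

end Product

/-! ### From ranges of the dual map to a permutation of separable pure states. -/

section Dual

variable {m n : ℕ}
  {Ψ : Matrix (Fin m × Fin n) (Fin m × Fin n) ℂ →ₗ[ℂ] Matrix (Fin m × Fin n) (Fin m × Fin n) ℂ}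

theorem trace_dualMap_mul (T : Matrix (Fin m × Fin n) (Fin m × Fin n) ℂ)
    {X : Matrix (Fin m × Fin n) (Fin m × Fin n) ℂ} (hX : X.IsHermitian) :
    (dualMap Ψ T * X).trace = (T * (Ψ X)ᴴ).trace := by
  have h := congrArg star (trace_dualMap Ψ X T)
  rw [← Matrix.trace_conjTranspose, ← Matrix.trace_conjTranspose, Matrix.conjTranspose_mul,
    Matrix.conjTranspose_mul, Matrix.conjTranspose_conjTranspose,
    Matrix.conjTranspose_conjTranspose, hX.eq] at h
  exact h.symm

theorem trace_sub_re {ι : Type*} [Fintype ι] (N Y : Matrix ι ι ℂ) :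
    ((N - Y)ᴴ * (N - Y)).trace.re =
      (Nᴴ * N).trace.re + (Yᴴ * Y).trace.re - 2 * (Nᴴ * Y).trace.re := by
  have h : (Yᴴ * N).trace = star (Nᴴ * Y).trace := by
    rw [← Matrix.trace_conjTranspose, Matrix.conjTranspose_mul, Matrix.conjTranspose_conjTranspose]
  rw [Matrix.conjTranspose_sub, sub_mul, mul_sub, mul_sub, Matrix.trace_sub, Matrix.trace_sub,
    Matrix.trace_sub, h]
  simp
  ring

/-- If dualizing preserves the convex hulls of all product numerical ranges, then every separable
pure state is the image of a separable pure state. -/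
theorem sepPureStates_subset_image
    (hb : ∀ T, convexHull ℝ (prodNumRange (dualMap Ψ T)) = convexHull ℝ (prodNumRange T))
    {X₀ : Matrix (Fin m × Fin n) (Fin m × Fin n) ℂ} (hX₀ : X₀ ∈ sepPureStates m n) :
    ∃ X ∈ sepPureStates m n, Ψ X = X₀ := by
  have hH := isHermitian_of_mem_sepPureStates hX₀
  -- Otherwise the range of `Ψ*(X₀)` lies in the open half-plane `Re z < 1`, while `tr (X₀ X₀) = 1`
  -- lies in the range of `X₀`.
  obtain ⟨X, hX, h1⟩ : ∃ X ∈ sepPureStates m n, 1 ≤ (X₀ * (Ψ X)ᴴ).trace.re := by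
    by_contra! hlt
    have hsub : convexHull ℝ (prodNumRange (dualMap Ψ X₀)) ⊆ {z : ℂ | z.re < 1} := by
      refine convexHull_min ?_ (convex_halfSpace_re_lt 1)
      rintro z ⟨X, hX, rfl⟩
      rw [trace_dualMap_mul X₀ (isHermitian_of_mem_sepPureStates hX)]
      exact hlt X hX
    rw [hb] at hsub
    have : (1 : ℂ).re < 1 := hsub (subset_convexHull ℝ _
      ⟨X₀, hX₀, (trace_mul_self_of_sepPure hX₀).symm⟩)
    simp at this
  refine ⟨X, hX, ?_⟩
  set N := (Ψ X)ᴴ with hN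
  have hN' : Nᴴ = Ψ X := Matrix.conjTranspose_conjTranspose _
  -- Now `T = Nᴴ = Ψ X`: the value `‖N‖²` lies in the range of `Ψ*(T)`, while the range of `T` has
  -- real parts at most `(‖N‖² + 1) / 2`, by `2 Re ⟨N, Y⟩ ≤ ‖N‖² + ‖Y‖²`.
  have h2 : (Nᴴ * N).trace.re ≤ 1 := by
    have hsub : convexHull ℝ (prodNumRange Nᴴ) ⊆ {z : ℂ | z.re ≤ ((Nᴴ * N).trace.re + 1) / 2} := by
      refine convexHull_min ?_ (convex_halfSpace_re_le _)
      rintro z ⟨Y, hY, rfl⟩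
      have a1 := trace_sub_re N Y
      have a2 := trace_conjTranspose_mul_self_re_nonneg (N - Y)
      rw [(isHermitian_of_mem_sepPureStates hY).eq, trace_mul_self_of_sepPure hY,
        Complex.one_re] at a1
      rw [Set.mem_ofPred_eq]
      linarith
    rw [← hb] at hsub
    have : (Nᴴ * N).trace.re ≤ ((Nᴴ * N).trace.re + 1) / 2 := hsub (subset_convexHull ℝ _
      ⟨X, hX, by rw [trace_dualMap_mul _ (isHermitian_of_mem_sepPureStates hX)]⟩)
    linarith
  -- `‖X₀ - N‖² = 1 + ‖N‖² - 2 Re tr (X₀ N) ≤ 1 + 1 - 2 = 0`.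
  have h3 := trace_sub_re X₀ N
  rw [hH.eq, trace_mul_self_of_sepPure hX₀, Complex.one_re] at h3
  have h4 := sub_eq_zero.mp (eq_zero_of_trace_conjTranspose_mul_self_re
    (A := X₀ - N) (by linarith))
  rw [← hN', ← h4, hH.eq]

theorem dualMap_comp_dualMap {Φ : Matrix (Fin m × Fin n) (Fin m × Fin n) ℂ →ₗ[ℂ]
    Matrix (Fin m × Fin n) (Fin m × Fin n) ℂ} (h : ∀ X, Φ (Ψ X) = X)
    (T : Matrix (Fin m × Fin n) (Fin m × Fin n) ℂ) : dualMap Ψ (dualMap Φ T) = T := by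
  have e1 := eq_dualMap (LinearMap.id) (fun Y => dualMap Ψ (dualMap Φ Y)) (fun X Y => by
    rw [← trace_dualMap, ← trace_dualMap, h, LinearMap.id_apply]) T
  have e2 := eq_dualMap (LinearMap.id) (fun Y => Y) (fun X Y => rfl) T
  exact e1.trans e2.symm

/-- If dualizing preserves the convex hulls of all product numerical ranges, then the map is a
bijection that restricts to a bijection of the set of separable pure states. -/
theorem image_sepPureStates
    (hb : ∀ T, convexHull ℝ (prodNumRange (dualMap Ψ T)) = convexHull ℝ (prodNumRange T)) :
    Function.Injective Ψ ∧ ∀ X, Ψ X ∈ sepPureStates m n ↔ X ∈ sepPureStates m n := by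
  have hsurj : Function.Surjective Ψ := by
    rw [← LinearMap.range_eq_top, eq_top_iff, ← span_sepPureStates, Submodule.span_le]
    intro X₀ hX₀
    obtain ⟨X, -, hX⟩ := sepPureStates_subset_image hb hX₀
    exact ⟨X, hX⟩
  have hinj : Function.Injective Ψ := LinearMap.injective_iff_surjective.mpr hsurj
  refine ⟨hinj, fun X => ⟨fun h => ?_, fun h => ?_⟩⟩
  · obtain ⟨Y, hY, e⟩ := sepPureStates_subset_image hb h
    exact hinj e ▸ hY
  · let Φ := (LinearEquiv.ofBijective Ψ ⟨hinj, hsurj⟩).symm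
    have hΦ : ∀ X, Φ.toLinearMap (Ψ X) = X := (LinearEquiv.ofBijective Ψ ⟨hinj, hsurj⟩).symm_apply_apply
    have hΨ : ∀ X, Ψ (Φ X) = X := (LinearEquiv.ofBijective Ψ ⟨hinj, hsurj⟩).apply_symm_apply
    -- The inverse satisfies the same hypothesis, because its dual is inverse to `dualMap Ψ`.
    obtain ⟨Y, hY, rfl⟩ := sepPureStates_subset_image (Ψ := Φ.toLinearMap) (fun T => by
      rw [← hb, dualMap_comp_dualMap hΦ]) h
    rw [LinearEquiv.coe_coe, hΨ]
    exact hY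

theorem prodNumRange_dualMap_of_image
    (h1 : ∀ X ∈ sepPureStates m n, Ψ X ∈ sepPureStates m n)
    (h2 : ∀ X ∈ sepPureStates m n, ∃ Y ∈ sepPureStates m n, Ψ Y = X)
    (T : Matrix (Fin m × Fin n) (Fin m × Fin n) ℂ) :
    prodNumRange (dualMap Ψ T) = prodNumRange T := by
  have key : ∀ X ∈ sepPureStates m n, (dualMap Ψ T * X).trace = (T * Ψ X).trace := fun X hX => by
    rw [trace_dualMap_mul T (isHermitian_of_mem_sepPureStates hX),
      (isHermitian_of_mem_sepPureStates (h1 X hX)).eq]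
  ext z
  constructor
  · rintro ⟨X, hX, rfl⟩
    exact ⟨Ψ X, h1 X hX, key X hX⟩
  · rintro ⟨X, hX, rfl⟩
    obtain ⟨Y, hY, rfl⟩ := h2 X hX
    exact ⟨Y, hY, (key Y hY).symm⟩

end Dual

/-! ### Natural forms permute pure states, which gives (c) ⇒ (a). -/

section ConjForm

variable {k : ℕ} {U : Matrix (Fin k) (Fin k) ℂ} {ψ : Matrix (Fin k) (Fin k) ℂ → Matrix (Fin k) (Fin k) ℂ}

theorem IsConjForm.mem_pureStates (hU : U ∈ Matrix.unitaryGroup (Fin k) ℂ) (h : IsConjForm U ψ)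
    {P : Matrix (Fin k) (Fin k) ℂ} (hP : P ∈ pureStates k) : ψ P ∈ pureStates k := by
  have hU' : Uᴴ * U = 1 := Matrix.mem_unitaryGroup_iff'.mp hU
  rcases h with h | h <;> rw [h]
  · exact conj_mem_pureStates hU' hP
  · exact conj_mem_pureStates hU' (transpose_mem_pureStates hP)

theorem IsConjForm.exists_eq (hU : U ∈ Matrix.unitaryGroup (Fin k) ℂ) (h : IsConjForm U ψ)
    {P : Matrix (Fin k) (Fin k) ℂ} (hP : P ∈ pureStates k) : ∃ Q ∈ pureStates k, ψ Q = P := by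
  have hU' : U * Uᴴ = 1 := Matrix.mem_unitaryGroup_iff.mp hU
  have hQ : Uᴴ * P * U ∈ pureStates k := by
    simpa using conj_mem_pureStates (U := Uᴴ) (by simpa using hU') hP
  have e : U * (Uᴴ * P * U) * Uᴴ = P := by
    rw [show U * (Uᴴ * P * U) * Uᴴ = (U * Uᴴ) * P * (U * Uᴴ) by simp only [mul_assoc], hU', one_mul,
      mul_one]
  rcases h with h | h
  · exact ⟨_, hQ, by rw [h, e]⟩
  · exact ⟨_, transpose_mem_pureStates hQ, by rw [h, Matrix.transpose_transpose, e]⟩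

end ConjForm

theorem HasNaturalForm.prodNumRange_dualMap {m n : ℕ}
    {Ψ : Matrix (Fin m × Fin n) (Fin m × Fin n) ℂ →ₗ[ℂ] Matrix (Fin m × Fin n) (Fin m × Fin n) ℂ}
    (h : HasNaturalForm Ψ) (T : Matrix (Fin m × Fin n) (Fin m × Fin n) ℂ) :
    prodNumRange (dualMap Ψ T) = prodNumRange T := by
  obtain ⟨U, hU, V, hV, ψ₁, ψ₂, h₁, h₂, h | ⟨rfl, h⟩⟩ := h
  · refine prodNumRange_dualMap_of_image ?_ ?_ T
    · rintro _ ⟨P, hP, Q, hQ, rfl⟩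
      rw [h P Q hP.1 hQ.1]
      exact kronecker_mem (h₁.mem_pureStates hU hP) (h₂.mem_pureStates hV hQ)
    · rintro _ ⟨P, hP, Q, hQ, rfl⟩
      obtain ⟨P', hP', rfl⟩ := h₁.exists_eq hU hP
      obtain ⟨Q', hQ', rfl⟩ := h₂.exists_eq hV hQ
      exact ⟨_, kronecker_mem hP' hQ', h P' Q' hP'.1 hQ'.1⟩
  · replace h : ∀ A B : Matrix (Fin m) (Fin m) ℂ, A.IsHermitian → B.IsHermitian →
        Ψ (A ⊗ₖ B) = ψ₂ B ⊗ₖ ψ₁ A := fun A B hA hB => by simpa using h A B hA hB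
    refine prodNumRange_dualMap_of_image ?_ ?_ T
    · rintro _ ⟨P, hP, Q, hQ, rfl⟩
      rw [h P Q hP.1 hQ.1]
      exact kronecker_mem (h₂.mem_pureStates hV hQ) (h₁.mem_pureStates hU hP)
    · rintro _ ⟨P, hP, Q, hQ, rfl⟩
      obtain ⟨P', hP', rfl⟩ := h₂.exists_eq hV hP
      obtain ⟨Q', hQ', rfl⟩ := h₁.exists_eq hU hQ
      exact ⟨_, kronecker_mem hQ' hP', h Q' P' hQ'.1 hP'.1⟩

/-! ### Automorphisms of the rook's graph. -/

section Rook

variable {α β : Type*}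

/-- Two points of a grid lie on a common line. -/
def Collinear (x y : α × β) : Prop := x.1 = y.1 ∨ x.2 = y.2

/-- Points of a row are pairwise collinear, so each row lands in one line. If rows `a` and `a'` land
in lines of different directions, `σ (a, b)` and `σ (a', b)` can share a first coordinate for at
most one `b`, and a second coordinate for at most one `b`; three values of `b` are too many. -/
theorem rows_parallel {γ δ : Type*} {σ : α × β → γ × δ} (hinj : Function.Injective σ)
    (hσ : ∀ x y, Collinear (σ x) (σ y) ↔ Collinear x y)
    (hβ : ∃ a b c : β, a ≠ b ∧ a ≠ c ∧ b ≠ c) :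
    (∀ a b b', (σ (a, b)).1 = (σ (a, b')).1) ∨ (∀ a b b', (σ (a, b)).2 = (σ (a, b')).2) := by
  have row : ∀ a, (∀ b b', (σ (a, b)).1 = (σ (a, b')).1) ∨
      (∀ b b', (σ (a, b)).2 = (σ (a, b')).2) := by
    intro a
    by_contra! h
    obtain ⟨⟨b, b', h1⟩, c, c', h2⟩ := h
    have col : ∀ b b', Collinear (σ (a, b)) (σ (a, b')) := fun b b' => (hσ _ _).mpr (Or.inl rfl)
    have hall : ∀ d, (σ (a, d)).2 = (σ (a, b)).2 := by
      intro d
      rcases col d b with e | e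
      · rcases col d b' with e' | e'
        · exact absurd (e.symm.trans e') h1
        · exact e'.trans ((col b b').resolve_left h1).symm
      · exact e
    exact h2 ((hall c).trans (hall c').symm)
  by_contra! h
  obtain ⟨⟨a, b, b', h1⟩, a', c, c', h2⟩ := h
  have hr := (row a).resolve_left fun h => h1 (h b b')
  have hr' := (row a').resolve_right fun h => h2 (h c c')
  have hne : a ≠ a' := by
    rintro rfl
    exact h1 (hr' b b')
  have hi : ∀ b c, (σ (a, b)).1 = (σ (a, c)).1 → b = c := fun b c h =>
    congrArg Prod.snd (hinj (Prod.ext h (hr b c)))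
  have hi' : ∀ b c, (σ (a', b)).2 = (σ (a', c)).2 → b = c := fun b c h =>
    congrArg Prod.snd (hinj (Prod.ext (hr' b c) h))
  have diag : ∀ b, Collinear (σ (a, b)) (σ (a', b)) := fun b => (hσ _ _).mpr (Or.inr rfl)
  obtain ⟨x, y, z, hxy, hxz, hyz⟩ := hβ
  have fst : ∀ b c, (σ (a, b)).1 = (σ (a', b)).1 → (σ (a, c)).1 = (σ (a', c)).1 → b = c :=
    fun b c h h' => hi b c (h.trans ((hr' b c).trans h'.symm))
  have snd : ∀ b c, (σ (a, b)).2 = (σ (a', b)).2 → (σ (a, c)).2 = (σ (a', c)).2 → b = c :=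
    fun b c h h' => hi' b c (h.symm.trans ((hr b c).trans h'))
  rcases diag x with ex | ex <;> rcases diag y with ey | ey <;> rcases diag z with ez | ez
  · exact hxy (fst _ _ ex ey)
  · exact hxy (fst _ _ ex ey)
  · exact hxz (fst _ _ ex ez)
  · exact hyz (snd _ _ ey ez)
  · exact hyz (fst _ _ ey ez)
  · exact hxz (snd _ _ ex ez)
  · exact hxy (snd _ _ ex ey)
  · exact hxy (snd _ _ ex ey)

/-- Automorphisms of a rook's graph with at least three rows and columns preserve or exchange the
two directions. -/
theorem exists_prod_of_collinear_iff {σ : α × β → α × β} (hσ : Function.Bijective σ)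
    (hcol : ∀ x y, Collinear (σ x) (σ y) ↔ Collinear x y)
    (hα : ∃ a b c : α, a ≠ b ∧ a ≠ c ∧ b ≠ c) (hβ : ∃ a b c : β, a ≠ b ∧ a ≠ c ∧ b ≠ c) :
    (∃ (f : α → α) (g : β → β), Function.Surjective f ∧ Function.Surjective g ∧
      ∀ a b, σ (a, b) = (f a, g b)) ∨
    (∃ (f : α → β) (g : β → α), Function.Surjective f ∧ Function.Surjective g ∧
      ∀ a b, σ (a, b) = (g b, f a)) := by
  have rows := rows_parallel hσ.1 hcol hβ
  have cols := rows_parallel (σ := σ ∘ Prod.swap) (hσ.1.comp Prod.swap_injective)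
    (fun x y => (hcol _ _).trans or_comm) hα
  simp only [Function.comp_apply, Prod.swap_prod_mk] at cols
  obtain ⟨a₀, a₁, -, ha, -⟩ := hα
  obtain ⟨b₀, b₁, -, hb, -⟩ := hβ
  rcases rows with hr | hr <;> rcases cols with hc | hc
  -- Here the first coordinate of `σ` is constant on the whole grid, against surjectivity.
  · exfalso
    obtain ⟨⟨x, y⟩, hx⟩ := hσ.2 (a₀, b₀)
    obtain ⟨⟨z, w⟩, hz⟩ := hσ.2 (a₁, b₀)
    have := (hr x y w).trans (hc w x z)
    rw [hx, hz] at this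
    exact ha this
  · left
    have key : ∀ a b, σ (a, b) = ((σ (a, b₀)).1, (σ (a₀, b)).2) :=
      fun a b => Prod.ext (hr a b b₀) (hc b a a₀)
    refine ⟨fun a => (σ (a, b₀)).1, fun b => (σ (a₀, b)).2, fun a => ?_, fun b => ?_, key⟩
    · obtain ⟨⟨x, y⟩, hx⟩ := hσ.2 (a, b₀)
      exact ⟨x, by rw [key] at hx; exact congrArg Prod.fst hx⟩
    · obtain ⟨⟨x, y⟩, hx⟩ := hσ.2 (a₀, b)
      exact ⟨y, by rw [key] at hx; exact congrArg Prod.snd hx⟩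
  · right
    have key : ∀ a b, σ (a, b) = ((σ (a₀, b)).1, (σ (a, b₀)).2) :=
      fun a b => Prod.ext (hc b a a₀) (hr a b b₀)
    refine ⟨fun a => (σ (a, b₀)).2, fun b => (σ (a₀, b)).1, fun a => ?_, fun b => ?_, key⟩
    · obtain ⟨⟨x, y⟩, hx⟩ := hσ.2 (a₀, a)
      exact ⟨x, by rw [key] at hx; exact congrArg Prod.snd hx⟩
    · obtain ⟨⟨x, y⟩, hx⟩ := hσ.2 (b, b₀)
      exact ⟨y, by rw [key] at hx; exact congrArg Prod.fst hx⟩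
  · exfalso
    obtain ⟨⟨x, y⟩, hx⟩ := hσ.2 (a₀, b₀)
    obtain ⟨⟨z, w⟩, hz⟩ := hσ.2 (a₀, b₁)
    have := (hr x y w).trans (hc w x z)
    rw [hx, hz] at this
    exact hb this

end Rook

/-! ### Sharing a factor, characterised through ambiguous sums. -/

section Adjacency

variable {m n : ℕ}

/-- The sum of two separable pure states has another such decomposition. -/
def SumAmbiguous (X Y : Matrix (Fin m × Fin n) (Fin m × Fin n) ℂ) : Prop :=
  ∃ Z ∈ sepPureStates m n, ∃ W ∈ sepPureStates m n, X + Y = Z + W ∧ Z ≠ X ∧ Z ≠ Y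

theorem trace_mul_one_sub {P Q : Matrix (Fin m) (Fin m) ℂ} (hP : P ∈ pureStates m)
    (hQ : Q ∈ pureStates m) :
    (P * (1 - Q)).trace = ((1 - (P * Q).trace.re : ℝ) : ℂ) := by
  rw [mul_sub, mul_one, Matrix.trace_sub, hP.2.2, trace_mul_im_of_pure hP hQ]
  simp

theorem trace_kronecker_mul_one_sub {P A : Matrix (Fin m) (Fin m) ℂ}
    {Q B : Matrix (Fin n) (Fin n) ℂ} (hP : P ∈ pureStates m) (hQ : Q ∈ pureStates n)
    (hA : A ∈ pureStates m) (hB : B ∈ pureStates n) :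
    ((A ⊗ₖ B) * ((1 - P) ⊗ₖ (1 - Q))).trace.re =
      (1 - (A * P).trace.re) * (1 - (B * Q).trace.re) := by
  rw [trace_kronecker_mul_kronecker, trace_mul_one_sub hA hP, trace_mul_one_sub hB hQ,
    ← Complex.ofReal_mul, Complex.ofReal_re]

/-- Pairing with `(1 - P₁) ⊗ (1 - Q₂)` kills both terms on the left; the terms on the right are
nonnegative, so each vanishes. -/
theorem eq_or_eq_of_add_eq_add {P₁ P₂ A C : Matrix (Fin m) (Fin m) ℂ}
    {Q₁ Q₂ B D : Matrix (Fin n) (Fin n) ℂ} (hP₁ : P₁ ∈ pureStates m) (hP₂ : P₂ ∈ pureStates m)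
    (hA : A ∈ pureStates m) (hC : C ∈ pureStates m) (hQ₁ : Q₁ ∈ pureStates n)
    (hQ₂ : Q₂ ∈ pureStates n) (hB : B ∈ pureStates n) (hD : D ∈ pureStates n)
    (h : P₁ ⊗ₖ Q₁ + P₂ ⊗ₖ Q₂ = A ⊗ₖ B + C ⊗ₖ D) : A = P₁ ∨ B = Q₂ := by
  have key := congrArg (fun X => (X * ((1 - P₁) ⊗ₖ (1 - Q₂))).trace.re) h
  simp only [add_mul, Matrix.trace_add, Complex.add_re,
    trace_kronecker_mul_one_sub hP₁ hQ₂ hP₁ hQ₁, trace_kronecker_mul_one_sub hP₁ hQ₂ hP₂ hQ₂,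
    trace_kronecker_mul_one_sub hP₁ hQ₂ hA hB, trace_kronecker_mul_one_sub hP₁ hQ₂ hC hD,
    trace_mul_self_of_pure hP₁, trace_mul_self_of_pure hQ₂, Complex.one_re, sub_self, zero_mul,
    mul_zero, add_zero] at key
  have a1 := trace_mul_re_le_one hA hP₁
  have a2 := trace_mul_re_le_one hB hQ₂
  have a3 := trace_mul_re_le_one hC hP₁
  have a4 := trace_mul_re_le_one hD hQ₂
  have h1 := mul_nonneg (sub_nonneg.mpr a1) (sub_nonneg.mpr a2)
  have h2 := mul_nonneg (sub_nonneg.mpr a3) (sub_nonneg.mpr a4)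
  have h3 : (1 - (A * P₁).trace.re) * (1 - (B * Q₂).trace.re) = 0 := by linarith
  rcases mul_eq_zero.mp h3 with h4 | h4
  · exact Or.inl (eq_of_trace_mul_re hA hP₁ (by linarith))
  · exact Or.inr (eq_of_trace_mul_re hB hQ₂ (by linarith))

/-- The phase `w` makes `x` and `w y` orthogonal in the real sense, so that `x + w y` and `x - w y`
have equal norms. -/
theorem exists_phase (z : ℂ) : ∃ w : ℂ, w * conj w = 1 ∧ (w * z).re = 0 := by
  by_cases hz : z = 0
  · exact ⟨1, by simp, by simp [hz]⟩
  · have hn : (‖z‖ : ℂ) ≠ 0 := by simpa using hz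
    have e : conj z * z = (‖z‖ : ℂ) ^ 2 := by rw [mul_comm, Complex.mul_conj']
    refine ⟨Complex.I * (conj z / ‖z‖), ?_, ?_⟩
    · simp only [map_mul, map_div₀, Complex.conj_I, Complex.conj_conj, Complex.conj_ofReal]
      field_simp
      rw [Complex.I_sq, ← e]
      ring
    · have : Complex.I * (conj z / ‖z‖) * z = Complex.I * (‖z‖ : ℂ) := by
        rw [mul_assoc, div_mul_eq_mul_div, e]
        field_simp
      rw [this]
      simp

/-- Two distinct pure states lie on the boundary of a ball of states, so their sum has another
decomposition. -/
theorem exists_add_eq_add {P Q : Matrix (Fin m) (Fin m) ℂ} (hP : P ∈ pureStates m)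
    (hQ : Q ∈ pureStates m) (hne : P ≠ Q) :
    ∃ A ∈ pureStates m, ∃ C ∈ pureStates m, P + Q = A + C ∧ A ≠ P ∧ A ≠ Q := by
  have hlt : (P * Q).trace.re < 1 := lt_of_not_ge fun h => hne (eq_of_trace_mul_re hP hQ h)
  obtain ⟨x, hx, rfl⟩ := exists_ketbra_of_mem_pureStates hP
  obtain ⟨y, hy, rfl⟩ := exists_ketbra_of_mem_pureStates hQ
  obtain ⟨w, hw, hre⟩ := exists_phase (star x ⬝ᵥ y)
  have hyx : star y ⬝ᵥ x = conj (star x ⬝ᵥ y) := by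
    rw [← Complex.star_def, ← Matrix.star_dotProduct_star]
    simp [dotProduct_comm]
  set c := star x ⬝ᵥ y with hc
  rw [trace_ketbra_mul_ketbra, ← hc, Complex.ofReal_re] at hlt
  have hwc : w * c + conj w * conj c = 0 := by
    rw [← map_mul, Complex.add_conj, hre]
    simp
  have hs : ((Real.sqrt 2)⁻¹ : ℂ) * (Real.sqrt 2 : ℂ)⁻¹ = 1 / 2 := by
    rw [← mul_inv, ← Complex.ofReal_mul, Real.mul_self_sqrt (by norm_num)]
    norm_num
  set s : ℂ := ((Real.sqrt 2 : ℝ) : ℂ)⁻¹ with hsdef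
  have hsc : conj s = s := by rw [hsdef, map_inv₀, Complex.conj_ofReal]
  -- The new pair consists of the projections onto `(x ± w y) / √2`; the cross terms cancel in their
  -- sum.
  have hz : star (s • (x + w • y)) ⬝ᵥ (s • (x + w • y)) = 1 := by
    simp only [star_smul, star_add, smul_dotProduct, dotProduct_smul, add_dotProduct,
      dotProduct_add, hx, hy, hyx, ← hc, Complex.star_def, hsc, smul_eq_mul]
    linear_combination (2 + w * c + conj w * conj c + (w * conj w - 1)) * hs + (1 / 2) * hwc
      + (1 / 2) * hw
  have hz' : star (s • (x - w • y)) ⬝ᵥ (s • (x - w • y)) = 1 := by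
    simp only [star_smul, star_sub, smul_dotProduct, dotProduct_smul, sub_dotProduct,
      dotProduct_sub, hx, hy, hyx, ← hc, Complex.star_def, hsc, smul_eq_mul]
    linear_combination (2 - w * c - conj w * conj c + (w * conj w - 1)) * hs - (1 / 2) * hwc
      + (1 / 2) * hw
  have hnorm : Complex.normSq s = 1 / 2 := by
    have := Complex.normSq_eq_conj_mul_self (z := s)
    rw [hsc, hs] at this
    apply Complex.ofReal_injective
    rw [this]
    norm_num
  have hwn : Complex.normSq w = 1 := by
    have := Complex.normSq_eq_conj_mul_self (z := w)
    rw [mul_comm, hw] at this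
    exact_mod_cast this
  have hre' : (w * c).re = 0 := hre
  have hlt' : Complex.normSq (w * c) < 1 := by rw [map_mul, hwn, one_mul]; exact hlt
  refine ⟨_, ketbra_mem_pureStates hz, _, ketbra_mem_pureStates hz', ?_, ?_, ?_⟩
  · ext i j
    simp only [Matrix.add_apply, ketbra_apply, Pi.smul_apply, Pi.add_apply, Pi.sub_apply,
      smul_eq_mul, map_mul, map_add, map_sub, hsc]
    linear_combination (-2 * (x i * conj (x j) + w * conj w * (y i * conj (y j)))) * hs
      - (y i * conj (y j)) * hw
  -- The overlap of the new state with `P` is `(1 + |c|²) / 2`, which is below 1 since `|c| < 1`.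
  · intro h
    have h1 := trace_mul_self_of_pure hP
    nth_rw 2 [← h] at h1
    rw [trace_ketbra_mul_ketbra, dotProduct_smul, dotProduct_add, dotProduct_smul, hx, ← hc,
      smul_eq_mul, smul_eq_mul, map_mul, hnorm, Complex.ofReal_eq_one, Complex.normSq_add,
      map_one, one_mul, Complex.conj_re, hre'] at h1
    linarith
  · intro h
    have h1 := trace_mul_self_of_pure hQ
    nth_rw 2 [← h] at h1
    have e : conj c + w * 1 = w * (1 + conj (w * c)) := by
      rw [map_mul]
      linear_combination (-conj c) * hw
    rw [trace_ketbra_mul_ketbra, dotProduct_smul, dotProduct_add, dotProduct_smul, hy, hyx,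
      smul_eq_mul, smul_eq_mul, e, map_mul, map_mul, hnorm, hwn, Complex.ofReal_eq_one,
      Complex.normSq_add, Complex.normSq_conj, map_one, one_mul, one_mul, Complex.conj_conj,
      hre'] at h1
    linarith

theorem sumAmbiguous_iff {P₁ P₂ : Matrix (Fin m) (Fin m) ℂ} {Q₁ Q₂ : Matrix (Fin n) (Fin n) ℂ}
    (hP₁ : P₁ ∈ pureStates m) (hP₂ : P₂ ∈ pureStates m) (hQ₁ : Q₁ ∈ pureStates n)
    (hQ₂ : Q₂ ∈ pureStates n) (hne : ¬ (P₁ = P₂ ∧ Q₁ = Q₂)) :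
    SumAmbiguous (P₁ ⊗ₖ Q₁) (P₂ ⊗ₖ Q₂) ↔ P₁ = P₂ ∨ Q₁ = Q₂ := by
  constructor
  · rintro ⟨_, ⟨A, hA, B, hB, rfl⟩, _, ⟨C, hC, D, hD, rfl⟩, h, h1, h2⟩
    have e1 := eq_or_eq_of_add_eq_add hP₁ hP₂ hA hC hQ₁ hQ₂ hB hD h
    have e2 := eq_or_eq_of_add_eq_add hP₂ hP₁ hA hC hQ₂ hQ₁ hB hD (by rw [add_comm, h])
    rcases e1 with rfl | rfl <;> rcases e2 with rfl | rfl
    · exact Or.inl rfl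
    · exact absurd rfl h1
    · exact absurd rfl h2
    · exact Or.inr rfl
  · rintro (rfl | rfl)
    · obtain ⟨B, hB, D, hD, h, h1, h2⟩ := exists_add_eq_add hQ₁ hQ₂ fun h => hne ⟨rfl, h⟩
      refine ⟨_, kronecker_mem hP₁ hB, _, kronecker_mem hP₁ hD, ?_, fun e => ?_, fun e => ?_⟩
      · rw [← Matrix.kronecker_add, ← Matrix.kronecker_add, h]
      · exact h1 (kronecker_inj hP₁ hP₁ hB hQ₁ e).2
      · exact h2 (kronecker_inj hP₁ hP₁ hB hQ₂ e).2
    · obtain ⟨B, hB, D, hD, h, h1, h2⟩ := exists_add_eq_add hP₁ hP₂ fun h => hne ⟨h, rfl⟩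
      refine ⟨_, kronecker_mem hB hQ₁, _, kronecker_mem hD hQ₁, ?_, fun e => ?_, fun e => ?_⟩
      · rw [← Matrix.add_kronecker, ← Matrix.add_kronecker, h]
      · exact h1 (kronecker_inj hB hP₁ hQ₁ hQ₁ e).1
      · exact h2 (kronecker_inj hB hP₂ hQ₁ hQ₁ e).1

theorem sumAmbiguous_map_iff
    {Ψ : Matrix (Fin m × Fin n) (Fin m × Fin n) ℂ →ₗ[ℂ] Matrix (Fin m × Fin n) (Fin m × Fin n) ℂ}
    (hinj : Function.Injective Ψ) (hΨ : ∀ X, Ψ X ∈ sepPureStates m n ↔ X ∈ sepPureStates m n)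
    (hsurj : Function.Surjective Ψ) (X Y : Matrix (Fin m × Fin n) (Fin m × Fin n) ℂ) :
    SumAmbiguous (Ψ X) (Ψ Y) ↔ SumAmbiguous X Y := by
  constructor
  · rintro ⟨Z, hZ, W, hW, h, h1, h2⟩
    obtain ⟨Z, rfl⟩ := hsurj Z
    obtain ⟨W, rfl⟩ := hsurj W
    refine ⟨Z, (hΨ Z).mp hZ, W, (hΨ W).mp hW, hinj ?_, fun e => h1 (e ▸ rfl), fun e => h2 (e ▸ rfl)⟩
    rw [map_add, map_add, h]
  · rintro ⟨Z, hZ, W, hW, h, h1, h2⟩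
    refine ⟨Ψ Z, (hΨ Z).mpr hZ, Ψ W, (hΨ W).mpr hW, ?_, hinj.ne h1, hinj.ne h2⟩
    rw [← map_add, ← map_add, h]

/-- A linear bijection preserving separable pure states acts on the factors separately, up to an
exchange. -/
theorem exists_factor_maps (hm : 2 ≤ m) (hn : 2 ≤ n)
    {Ψ : Matrix (Fin m × Fin n) (Fin m × Fin n) ℂ →ₗ[ℂ] Matrix (Fin m × Fin n) (Fin m × Fin n) ℂ}
    (hinj : Function.Injective Ψ) (hΨ : ∀ X, Ψ X ∈ sepPureStates m n ↔ X ∈ sepPureStates m n) :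
    (∃ (f : pureStates m → pureStates m) (g : pureStates n → pureStates n),
      Function.Surjective f ∧ Function.Surjective g ∧
      ∀ (P : pureStates m) (Q : pureStates n), Ψ (P.1 ⊗ₖ Q.1) = (f P).1 ⊗ₖ (g Q).1) ∨
    (∃ (f : pureStates m → pureStates n) (g : pureStates n → pureStates m),
      Function.Surjective f ∧ Function.Surjective g ∧
      ∀ (P : pureStates m) (Q : pureStates n), Ψ (P.1 ⊗ₖ Q.1) = (g Q).1 ⊗ₖ (f P).1) := by
  have hsurj : Function.Surjective Ψ := LinearMap.injective_iff_surjective.mp hinj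
  have hex : ∀ x : pureStates m × pureStates n, ∃ y : pureStates m × pureStates n,
      Ψ (x.1.1 ⊗ₖ x.2.1) = y.1.1 ⊗ₖ y.2.1 := by
    rintro ⟨P, Q⟩
    obtain ⟨A, hA, B, hB, h⟩ := (hΨ _).mpr (kronecker_mem P.2 Q.2)
    exact ⟨(⟨A, hA⟩, ⟨B, hB⟩), h⟩
  choose σ hσ using hex
  have kinj : ∀ x y : pureStates m × pureStates n, x.1.1 ⊗ₖ x.2.1 = y.1.1 ⊗ₖ y.2.1 → x = y := by
    intro x y h
    obtain ⟨h1, h2⟩ := kronecker_inj x.1.2 y.1.2 x.2.2 y.2.2 h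
    exact Prod.ext (Subtype.ext h1) (Subtype.ext h2)
  have hσinj : Function.Injective σ := fun x y h =>
    kinj _ _ (hinj (by rw [hσ, hσ, h]))
  have hbij : Function.Bijective σ := by
    refine ⟨hσinj, fun y => ?_⟩
    obtain ⟨X, hX⟩ := hsurj (y.1.1 ⊗ₖ y.2.1)
    have hX' := kronecker_mem y.1.2 y.2.2
    rw [← hX, hΨ] at hX'
    obtain ⟨A, hA, B, hB, rfl⟩ := hX'
    exact ⟨(⟨A, hA⟩, ⟨B, hB⟩), kinj _ _ ((hσ (⟨A, hA⟩, ⟨B, hB⟩)).symm.trans hX)⟩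
  have amb : ∀ x y : pureStates m × pureStates n, x ≠ y →
      (SumAmbiguous (x.1.1 ⊗ₖ x.2.1) (y.1.1 ⊗ₖ y.2.1) ↔ Collinear x y) := by
    intro x y hxy
    rw [sumAmbiguous_iff x.1.2 y.1.2 x.2.2 y.2.2, Collinear, Subtype.ext_iff, Subtype.ext_iff]
    exact fun h => hxy (Prod.ext (Subtype.ext h.1) (Subtype.ext h.2))
  have hcol : ∀ x y, Collinear (σ x) (σ y) ↔ Collinear x y := by
    intro x y
    by_cases hxy : x = y
    · subst hxy
      exact iff_of_true (Or.inl rfl) (Or.inl rfl)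
    · rw [← amb x y hxy, ← amb _ _ (hσinj.ne hxy), ← hσ, ← hσ, sumAmbiguous_map_iff hinj hΨ hsurj]
  rcases exists_prod_of_collinear_iff hbij hcol (exists_three_pureStates hm)
    (exists_three_pureStates hn) with ⟨f, g, hf, hg, h⟩ | ⟨f, g, hf, hg, h⟩
  · exact Or.inl ⟨f, g, hf, hg, fun P Q => by rw [hσ (P, Q), h]⟩
  · exact Or.inr ⟨f, g, hf, hg, fun P Q => by rw [hσ (P, Q), h]⟩

end Adjacency

/-! ### Trace estimates for linear maps of pure states to pure states. -/

section Surjective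

variable {m k : ℕ}

/-- Spectral decomposition of a Hermitian matrix into pure states. -/
theorem exists_pure_resolution {A : Matrix (Fin m) (Fin m) ℂ} (hA : A.IsHermitian) :
    ∃ (c : Fin m → ℝ) (P : Fin m → Matrix (Fin m) (Fin m) ℂ), (∀ i, P i ∈ pureStates m) ∧
      (∀ i j, (P i * P j).trace = if i = j then 1 else 0) ∧ ∑ i, P i = 1 ∧
      A = ∑ i, (c i : ℂ) • P i := by
  obtain ⟨v, hv, h1, hs⟩ := exists_spectral hA
  refine ⟨_, fun i => ketbra (v i), fun i => ketbra_mem_pureStates (by simpa using hv i i),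
    fun i j => ?_, h1, hs⟩
  rw [trace_ketbra_mul_ketbra, hv]
  split_ifs <;> simp

theorem trace_sum_smul_mul {c : Fin m → ℝ} {P : Fin m → Matrix (Fin m) (Fin m) ℂ}
    (h : ∀ i j, (P i * P j).trace = if i = j then 1 else 0) (j : Fin m) :
    ((∑ i, (c i : ℂ) • P i) * P j).trace = c j := by
  simp [Finset.sum_mul, Matrix.trace_sum, h]

variable {F : Matrix (Fin m) (Fin m) ℂ →ₗ[ℂ] Matrix (Fin k) (Fin k) ℂ}

/-- With `1 = ∑ Rᵢ`, `P = ∑ cᵢ Rᵢ` and `cᵢ ≤ 1`, the trace is `∑ tr (F Rᵢ F P) ≥ ∑ cᵢ tr (F Rᵢ F P)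
= tr (F P F P) = 1`. -/
theorem one_le_trace_map_one_mul (hF : ∀ P ∈ pureStates m, F P ∈ pureStates k)
    {P : Matrix (Fin m) (Fin m) ℂ} (hP : P ∈ pureStates m) : 1 ≤ (F 1 * F P).trace.re := by
  obtain ⟨c, R, hR, hort, h1, hs⟩ := exists_pure_resolution hP.1
  have hc : ∀ i, c i ≤ 1 := fun i => by
    have h := trace_mul_re_le_one hP (hR i)
    rwa [hs, trace_sum_smul_mul hort, Complex.ofReal_re] at h
  have e1 : (F 1 * F P).trace.re = ∑ i, (F (R i) * F P).trace.re := by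
    rw [← h1, map_sum, Finset.sum_mul, Matrix.trace_sum, Complex.re_sum]
  have e2 : (F P * F P).trace.re = ∑ i, c i * (F (R i) * F P).trace.re := by
    nth_rw 1 [hs]
    rw [map_sum, Finset.sum_mul, Matrix.trace_sum, Complex.re_sum]
    refine Finset.sum_congr rfl fun i _ => ?_
    rw [map_smul, Matrix.smul_mul, Matrix.trace_smul, smul_eq_mul, Complex.re_ofReal_mul]
  rw [trace_mul_self_of_pure (hF P hP), Complex.one_re] at e2
  rw [e1, e2]
  exact Finset.sum_le_sum fun i _ => mul_le_of_le_one_left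
    (trace_mul_re_nonneg (hF _ (hR i)) (hF P hP)) (hc i)

theorem trace_map_one (hF : ∀ P ∈ pureStates m, F P ∈ pureStates k) : (F 1).trace = m := by
  obtain ⟨c, R, hR, -, h1, -⟩ := exists_pure_resolution (Matrix.isHermitian_zero (n := Fin m) (α := ℂ))
  rw [← h1, map_sum, Matrix.trace_sum, Finset.sum_congr rfl fun i _ => (hF _ (hR i)).2.2]
  simp

theorem isHermitian_map_one (hF : ∀ P ∈ pureStates m, F P ∈ pureStates k) :
    (F 1).IsHermitian := by
  obtain ⟨c, R, hR, -, h1, -⟩ := exists_pure_resolution (Matrix.isHermitian_zero (n := Fin m) (α := ℂ))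
  rw [← h1, map_sum, Matrix.IsHermitian, Matrix.conjTranspose_sum]
  exact Finset.sum_congr rfl fun i _ => (hF _ (hR i)).1.eq

/-- A linear map sending pure states onto pure states does not increase the dimension. -/
theorem card_le_of_surjOn_pureStates (hF : ∀ P ∈ pureStates m, F P ∈ pureStates k)
    (hs : ∀ R ∈ pureStates k, ∃ P ∈ pureStates m, F P = R) : k ≤ m := by
  obtain ⟨c, R, hR, -, h1, -⟩ := exists_pure_resolution (Matrix.isHermitian_zero (n := Fin k) (α := ℂ))
  -- Expanding `tr (F 1) = m` over a resolution of the identity of size `k` gives `k` terms, each at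
  -- least 1.
  have e : ((m : ℂ)).re = ∑ i, (F 1 * R i).trace.re := by
    rw [← trace_map_one hF, ← Complex.re_sum, ← Matrix.trace_sum, ← Finset.mul_sum, h1, mul_one]
  have h : ∑ _i : Fin k, (1 : ℝ) ≤ ∑ i, (F 1 * R i).trace.re := Finset.sum_le_sum fun i _ => by
    obtain ⟨P, hP, e⟩ := hs _ (hR i)
    rw [← e]
    exact one_le_trace_map_one_mul hF hP
  rw [← e] at h
  simpa using h

end Surjective

/-! ### Wigner's theorem for linear maps. -/

section Preserver

variable {m : ℕ} {F : Matrix (Fin m) (Fin m) ℂ →ₗ[ℂ] Matrix (Fin m) (Fin m) ℂ}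

/-- Each spectral projection of `F 1` is the image of a pure state, so each eigenvalue is at least
1; they sum to `m`. -/
theorem map_one_of_surjOn_pureStates (hF : ∀ P ∈ pureStates m, F P ∈ pureStates m)
    (hs : ∀ R ∈ pureStates m, ∃ P ∈ pureStates m, F P = R) : F 1 = 1 := by
  obtain ⟨c, R, hR, hort, h1, e⟩ := exists_pure_resolution (isHermitian_map_one hF)
  have hc : ∀ i, 1 ≤ c i := fun i => by
    obtain ⟨P, hP, hPR⟩ := hs _ (hR i)
    have h := one_le_trace_map_one_mul hF hP
    rwa [hPR, e, trace_sum_smul_mul hort, Complex.ofReal_re] at h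
  have hsum : ∑ i, c i = ∑ _i : Fin m, (1 : ℝ) := by
    have h := trace_map_one hF
    rw [e, Matrix.trace_sum] at h
    simp only [Matrix.trace_smul, (hR _).2.2, smul_eq_mul, mul_one, ← Complex.ofReal_sum] at h
    simpa using congrArg Complex.re h
  have hc1 : ∀ i, c i = 1 := fun i =>
    (((Finset.sum_eq_sum_iff_of_le fun i _ => hc i).mp hsum.symm) i (Finset.mem_univ i)).symm
  rw [e, ← h1]
  exact Finset.sum_congr rfl fun i _ => by rw [hc1, Complex.ofReal_one, one_smul]

/-- A linear map preserving pure states and the trace form. -/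
structure PreservesPure (F : Matrix (Fin m) (Fin m) ℂ →ₗ[ℂ] Matrix (Fin m) (Fin m) ℂ) : Prop where
  pure : ∀ P ∈ pureStates m, F P ∈ pureStates m
  trace : ∀ A B, (F A * F B).trace = (A * B).trace

/-- For fixed `i` the nonnegative overlaps sum to `tr (F Rᵢ) = 1`, which the diagonal term already
exhausts. -/
theorem trace_map_mul_map_of_resolution (hF : ∀ P ∈ pureStates m, F P ∈ pureStates m)
    (hF1 : F 1 = 1) {R : Fin m → Matrix (Fin m) (Fin m) ℂ} (hR : ∀ i, R i ∈ pureStates m)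
    (h1 : ∑ i, R i = 1) (i j : Fin m) :
    (F (R i) * F (R j)).trace = if i = j then 1 else 0 := by
  split_ifs with hij
  · rw [hij, trace_mul_self_of_pure (hF _ (hR j))]
  · have e : ∑ l, (F (R i) * F (R l)).trace.re = 1 := by
      rw [← Complex.re_sum, ← Matrix.trace_sum, ← Finset.mul_sum, ← map_sum, h1, hF1, mul_one,
        (hF _ (hR i)).2.2, Complex.one_re]
    rw [← Finset.add_sum_erase _ _ (Finset.mem_univ i), trace_mul_self_of_pure (hF _ (hR i)),
      Complex.one_re, add_eq_left, Finset.sum_eq_zero_iff_of_nonneg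
        fun l _ => trace_mul_re_nonneg (hF _ (hR i)) (hF _ (hR l))] at e
    rw [trace_mul_im_of_pure (hF _ (hR i)) (hF _ (hR j)),
      e j (Finset.mem_erase.mpr ⟨Ne.symm hij, Finset.mem_univ j⟩), Complex.ofReal_zero]

/-- Spectral resolutions give `tr (F A)² = tr A²` for Hermitian `A`; polarization on pure states and
bilinearity do the rest. -/
theorem preservesPure_of_surjOn (hF : ∀ P ∈ pureStates m, F P ∈ pureStates m)
    (hs : ∀ R ∈ pureStates m, ∃ P ∈ pureStates m, F P = R) : PreservesPure F := by
  have hF1 := map_one_of_surjOn_pureStates hF hs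
  have hsq : ∀ A : Matrix (Fin m) (Fin m) ℂ, A.IsHermitian → (F A * F A).trace = (A * A).trace := by
    intro A hA
    obtain ⟨c, R, hR, hort, h1, e⟩ := exists_pure_resolution hA
    have h := trace_map_mul_map_of_resolution hF hF1 hR h1
    rw [e]
    simp only [map_sum, map_smul, Finset.sum_mul, Finset.mul_sum, Matrix.trace_sum, Matrix.smul_mul,
      Matrix.mul_smul, Matrix.trace_smul, h, hort]
  refine ⟨hF, fun A B => ?_⟩
  let τ : Matrix (Fin m) (Fin m) ℂ →ₗ[ℂ] Matrix (Fin m) (Fin m) ℂ →ₗ[ℂ] ℂ :=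
    (LinearMap.mul ℂ (Matrix (Fin m) (Fin m) ℂ)).compr₂ (Matrix.traceLinearMap (Fin m) ℂ ℂ)
  have h : τ.compl₁₂ F F = τ := bilinear_ext_pure fun P hP Q hQ => by
    change (F P * F Q).trace = (P * Q).trace
    have h := hsq (P + Q) (hP.1.add hQ.1)
    rw [map_add, add_mul, mul_add, mul_add, add_mul, mul_add, mul_add] at h
    simp only [Matrix.trace_add, hsq P hP.1, hsq Q hQ.1, Matrix.trace_mul_comm (F Q) (F P),
      Matrix.trace_mul_comm Q P] at h
    linear_combination (1 / 2) * h
  exact LinearMap.congr_fun₂ h A B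

theorem ketbra_smul (c : ℂ) (v : Fin m → ℂ) :
    ketbra (c • v) = (Complex.normSq c : ℂ) • ketbra v := by
  ext i j
  simp only [ketbra_apply, Pi.smul_apply, Matrix.smul_apply, smul_eq_mul, map_mul,
    Complex.normSq_eq_conj_mul_self]
  ring

theorem dotProduct_star_self (v : Fin m → ℂ) :
    star v ⬝ᵥ v = ((∑ i, Complex.normSq (v i) : ℝ) : ℂ) := by
  simp [dotProduct, Complex.normSq_eq_conj_mul_self]

theorem PreservesPure.exists_ketbra (hF : PreservesPure F) (v : Fin m → ℂ) :
    ∃ w, F (ketbra v) = ketbra w := by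
  set r : ℝ := ∑ i, Complex.normSq (v i) with hr
  have hr0 : 0 ≤ r := Finset.sum_nonneg fun i _ => Complex.normSq_nonneg _
  rcases hr0.eq_or_lt with h0 | hpos
  · have hv : v = 0 := by
      funext i
      have := (Finset.sum_eq_zero_iff_of_nonneg fun i _ => Complex.normSq_nonneg (v i)).mp
        (hr.symm.trans h0.symm) i (Finset.mem_univ i)
      exact Complex.normSq_eq_zero.mp this
    refine ⟨0, ?_⟩
    have hk : ketbra (0 : Fin m → ℂ) = 0 := by
      ext i j
      simp [ketbra_apply]
    rw [hv, hk, map_zero]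
  · have hsq : Real.sqrt r ≠ 0 := (Real.sqrt_pos.mpr hpos).ne'
    have hv : v = ((Real.sqrt r : ℝ) : ℂ) • (((Real.sqrt r)⁻¹ : ℝ) : ℂ) • v := by
      rw [smul_smul, ← Complex.ofReal_mul, mul_inv_cancel₀ hsq, Complex.ofReal_one, one_smul]
    set u := (((Real.sqrt r)⁻¹ : ℝ) : ℂ) • v with hu
    have hu1 : star u ⬝ᵥ u = 1 := by
      rw [hu, dotProduct_star_self]
      simp only [Pi.smul_apply, smul_eq_mul, map_mul, Complex.normSq_ofReal, ← Finset.mul_sum]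
      rw [← hr, ← mul_inv, Real.mul_self_sqrt hr0, inv_mul_cancel₀ hpos.ne', Complex.ofReal_one]
    obtain ⟨w, -, hw⟩ := exists_ketbra_of_mem_pureStates (hF.pure _ (ketbra_mem_pureStates hu1))
    exact ⟨((Real.sqrt r : ℝ) : ℂ) • w, by rw [hv, ketbra_smul, map_smul, hw, ← ketbra_smul]⟩

theorem PreservesPure.normSq_dotProduct (hF : PreservesPure F) {x x' y y' : Fin m → ℂ}
    (h : F (ketbra x) = ketbra x') (h' : F (ketbra y) = ketbra y') :
    Complex.normSq (star x' ⬝ᵥ y') = Complex.normSq (star x ⬝ᵥ y) := by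
  have e := hF.trace (ketbra x) (ketbra y)
  rw [h, h', trace_ketbra_mul_ketbra, trace_ketbra_mul_ketbra] at e
  exact_mod_cast e

/-- The standard basis vector. -/
def stdVec (i : Fin m) : Fin m → ℂ := Pi.single i 1

theorem star_stdVec_dotProduct (i : Fin m) (v : Fin m → ℂ) : star (stdVec i) ⬝ᵥ v = v i := by
  simp [stdVec]

theorem trace_mul_ketbra_pair (A : Matrix (Fin m) (Fin m) ℂ) (i j : Fin m) (c : ℂ) :
    (A * ketbra (stdVec i + c • stdVec j)).trace =
      A i i + c * A i j + conj c * A j i + c * conj c * A j j := by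
  simp only [trace_mul_ketbra, stdVec, Matrix.mulVec_add, Matrix.mulVec_smul, star_add, star_smul,
    add_dotProduct, dotProduct_add, smul_dotProduct, dotProduct_smul]
  simp
  ring

/-! ### Maps fixing the coordinate projections and the all-ones matrix. -/

section Normalized

variable (hF : PreservesPure F) (hE : ∀ i, F (ketbra (stdVec i)) = ketbra (stdVec i))
  (hJ : F (ketbra 1) = ketbra 1)
include hF hE

theorem PreservesPure.normSq_apply {x y : Fin m → ℂ} (h : F (ketbra x) = ketbra y) (i : Fin m) :
    Complex.normSq (y i) = Complex.normSq (x i) := by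
  simpa [star_stdVec_dotProduct] using hF.normSq_dotProduct (hE i) h

theorem PreservesPure.apply_diag (A : Matrix (Fin m) (Fin m) ℂ) (i : Fin m) : F A i i = A i i := by
  have h := hF.trace A (ketbra (stdVec i))
  rw [hE, trace_mul_ketbra, trace_mul_ketbra, star_stdVec_dotProduct, star_stdVec_dotProduct] at h
  simpa [stdVec] using h

include hJ

/-- Moduli of coordinates are preserved, so the image vector is a phase times `eᵢ + d eⱼ`. Pairing
with the all-ones vector gives `|1 + d| = |1 + c|`, hence equal real parts. -/
theorem PreservesPure.exists_pair {i j : Fin m} (hij : i ≠ j) {c : ℂ} (hc : Complex.normSq c = 1) :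
    ∃ d : ℂ, Complex.normSq d = 1 ∧ d.re = c.re ∧
      F (ketbra (stdVec i + c • stdVec j)) = ketbra (stdVec i + d • stdVec j) := by
  obtain ⟨y, hy⟩ := hF.exists_ketbra (stdVec i + c • stdVec j)
  have hn := hF.normSq_apply hE hy
  have hi : Complex.normSq (y i) = 1 := by simp [hn, stdVec, hij]
  have hj : Complex.normSq (y j) = 1 := by simp [hn, stdVec, hij.symm, hc]
  have hl : ∀ l, l ≠ i → l ≠ j → y l = 0 := fun l h1 h2 => by
    rw [← Complex.normSq_eq_zero, hn]
    simp [stdVec, h1, h2]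
  have hii : y i * conj (y i) = 1 := by rw [Complex.mul_conj, hi, Complex.ofReal_one]
  set d := y j * conj (y i) with hd
  have hd1 : Complex.normSq d = 1 := by rw [hd, map_mul, Complex.normSq_conj, hi, hj, one_mul]
  have hyd : y = y i • (stdVec i + d • stdVec j) := by
    funext l
    by_cases h1 : l = i
    · subst h1
      simp [stdVec, hij]
    · by_cases h2 : l = j
      · subst h2
        simp only [stdVec, hd, Pi.smul_apply, Pi.add_apply, Pi.single_eq_same, smul_eq_mul, mul_one,
          Pi.single_eq_of_ne h1, zero_add]
        linear_combination (-y l) * hii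
      · simp [stdVec, h1, h2, hl l h1 h2]
  have hFd : F (ketbra (stdVec i + c • stdVec j)) = ketbra (stdVec i + d • stdVec j) := by
    rw [hy, hyd, ketbra_smul, hi, Complex.ofReal_one, one_smul]
  refine ⟨d, hd1, ?_, hFd⟩
  have h := hF.normSq_dotProduct hJ hFd
  have hsum : ∀ e : ℂ, star (1 : Fin m → ℂ) ⬝ᵥ (stdVec i + e • stdVec j) = 1 + e := fun e => by
    simp [stdVec, dotProduct_add]
  rw [hsum, hsum, Complex.normSq_add, Complex.normSq_add, hd1, hc] at h
  simpa using h

/-- Taking `c = 1` forces `d = 1` and preserves the sum of the two entries; `c = I` forces `d = ±I`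
and preserves their difference up to sign. -/
theorem PreservesPure.entry_cases {i j : Fin m} (hij : i ≠ j) :
    (∀ A, F A i j = A i j ∧ F A j i = A j i) ∨ (∀ A, F A i j = A j i ∧ F A j i = A i j) := by
  have hd := hF.apply_diag hE
  have hsum : ∀ A, F A i j + F A j i = A i j + A j i := by
    obtain ⟨d, h1, h2, h3⟩ := hF.exists_pair hE hJ hij (c := 1) (by simp)
    have hd1 : d = 1 := by
      rw [Complex.normSq_apply, h2] at h1
      refine Complex.ext h2 ?_
      simpa using h1
    subst hd1
    intro A
    have h := hF.trace A (ketbra (stdVec i + (1 : ℂ) • stdVec j))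
    rw [h3, trace_mul_ketbra_pair, trace_mul_ketbra_pair, hd, hd, map_one] at h
    linear_combination h
  obtain ⟨d, h1, h2, h3⟩ := hF.exists_pair hE hJ hij (c := Complex.I) (by simp)
  have hdI : d = Complex.I ∨ d = -Complex.I := by
    rw [Complex.normSq_apply, h2] at h1
    have : d.im * d.im = 1 := by simpa using h1
    rcases mul_self_eq_one_iff.mp this with h | h
    · exact Or.inl (Complex.ext h2 h)
    · exact Or.inr (Complex.ext (by simpa using h2) (by simpa using h))
  have htr := fun A => hF.trace A (ketbra (stdVec i + Complex.I • stdVec j))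
  simp only [h3, trace_mul_ketbra_pair, hd] at htr
  rcases hdI with rfl | rfl
  · left
    intro A
    have e := htr A
    have hs := hsum A
    simp only [Complex.conj_I] at e
    have e' : F A i j - F A j i = A i j - A j i := by
      apply mul_left_cancel₀ Complex.I_ne_zero
      linear_combination e
    exact ⟨by linear_combination (hs + e') / 2, by linear_combination (hs - e') / 2⟩
  · right
    intro A
    have e := htr A
    have hs := hsum A
    simp only [map_neg, Complex.conj_I] at e
    have e' : F A j i - F A i j = A i j - A j i := by
      apply mul_left_cancel₀ Complex.I_ne_zero
      linear_combination e
    exact ⟨by linear_combination (hs - e') / 2, by linear_combination (hs + e') / 2⟩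

theorem PreservesPure.entry_consistent {i j k : Fin m} (hij : i ≠ j) (hik : i ≠ k) (hjk : j ≠ k)
    (h1 : ∀ A, F A i k = A i k ∧ F A k i = A k i) :
    ∀ A, F A j k = A j k ∧ F A k j = A k j := by
  refine (hF.entry_cases hE hJ hjk).resolve_right fun h2 => ?_
  -- With mixed behaviour, the image `y yᴴ` of `x xᴴ` would have `yᵢ = yⱼ`, but `-I` and `I` as its
  -- entries `(i, k)` and `(j, k)`.
  set x : Fin m → ℂ := stdVec i + stdVec j + Complex.I • stdVec k with hx
  have xi : x i = 1 := by simp [hx, stdVec, hij, hik]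
  have xj : x j = 1 := by simp [hx, stdVec, hij.symm, hjk]
  have xk : x k = Complex.I := by simp [hx, stdVec, hik.symm, hjk.symm]
  obtain ⟨y, hy⟩ := hF.exists_ketbra x
  have e1 := (h1 (ketbra x)).1
  have e2 := (h2 (ketbra x)).1
  have e3 : F (ketbra x) i j = 1 := by
    rcases hF.entry_cases hE hJ hij with h | h <;> rw [(h _).1, ketbra_apply, xi, xj] <;> simp
  have e4 := hF.apply_diag hE (ketbra x) j
  rw [hy] at e1 e2 e3 e4
  simp only [ketbra_apply, xi, xj, xk, map_one, one_mul, mul_one, Complex.conj_I] at e1 e2 e3 e4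
  have h : y i = y j := by linear_combination (-y i) * e4 + y j * e3
  rw [h, e2] at e1
  have := congrArg Complex.im e1
  norm_num at this

theorem PreservesPure.eq_id_or_transpose : (∀ A, F A = A) ∨ (∀ A, F A = Aᵀ) := by
  have hd := hF.apply_diag hE
  by_cases hq : ∀ i j A, F A i j = A j i
  · right
    intro A
    ext i j
    exact hq i j A
  · left
    push Not at hq
    obtain ⟨i, j, B, hB⟩ := hq
    have hij : i ≠ j := by
      rintro rfl
      exact hB (hd B i)
    -- Untransposed behaviour passes between pairs sharing an index; two passes reach every pair.
    have step : ∀ {i j l : Fin m}, i ≠ j → l ≠ j → (∀ A, F A i j = A i j ∧ F A j i = A j i) →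
        ∀ A, F A l j = A l j ∧ F A j l = A j l := by
      intro i j l hij hlj h
      by_cases hil : i = l
      · exact hil ▸ h
      · exact hF.entry_consistent hE hJ hil hij hlj h
    have hp := (hF.entry_cases hE hJ hij).resolve_right fun h => hB (h B).1
    intro A
    ext k l
    by_cases hkl : k = l
    · rw [hkl, hd]
    · by_cases hkj : k = j
      · subst hkj
        exact (step hij (Ne.symm hkl) hp A).2
      · exact (step (Ne.symm hkj) (Ne.symm hkl) (fun A => (step hij hkj hp A).symm) A).2

end Normalized

/-- Conjugation by a matrix, after a linear map. -/
def conjAfter (U : Matrix (Fin m) (Fin m) ℂ)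
    (F : Matrix (Fin m) (Fin m) ℂ →ₗ[ℂ] Matrix (Fin m) (Fin m) ℂ) :
    Matrix (Fin m) (Fin m) ℂ →ₗ[ℂ] Matrix (Fin m) (Fin m) ℂ :=
  LinearMap.mulLeft ℂ Uᴴ ∘ₗ LinearMap.mulRight ℂ U ∘ₗ F

theorem conjAfter_apply (U A : Matrix (Fin m) (Fin m) ℂ) : conjAfter U F A = Uᴴ * F A * U := by
  simp [conjAfter, mul_assoc]

theorem PreservesPure.conjAfter (hF : PreservesPure F) {U : Matrix (Fin m) (Fin m) ℂ}
    (hU : Uᴴ * U = 1) : PreservesPure (conjAfter U F) := by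
  have hU' : U * Uᴴ = 1 := mul_eq_one_comm.mp hU
  refine ⟨fun P hP => ?_, fun A B => ?_⟩
  · rw [conjAfter_apply]
    simpa using conj_mem_pureStates (U := Uᴴ) (by simpa using hU') (hF.pure P hP)
  · rw [conjAfter_apply, conjAfter_apply, ← hF.trace A B,
      show Uᴴ * F A * U * (Uᴴ * F B * U) = Uᴴ * (F A * (U * Uᴴ) * F B * U) by
        simp only [mul_assoc], hU', mul_one, Matrix.trace_mul_comm, mul_assoc, mul_assoc, hU',
      mul_one]

theorem ketbra_conjAfter (U : Matrix (Fin m) (Fin m) ℂ) {x y : Fin m → ℂ}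
    (h : F (ketbra x) = ketbra y) : conjAfter U F (ketbra x) = ketbra (Uᴴ *ᵥ y) := by
  rw [conjAfter_apply, h, ← conj_mul_ketbra_mul, Matrix.conjTranspose_conjTranspose]

/-- Wigner's theorem for linear maps: a linear map preserving pure states and the trace form is a
unitary conjugation, possibly composed with transposition. -/
theorem PreservesPure.exists_isConjForm (hF : PreservesPure F) :
    ∃ U ∈ Matrix.unitaryGroup (Fin m) ℂ, IsConjForm U F := by
  have hex : ∀ i, ∃ u : Fin m → ℂ, star u ⬝ᵥ u = 1 ∧ F (ketbra (stdVec i)) = ketbra u := fun i =>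
    exists_ketbra_of_mem_pureStates (hF.pure _ (ketbra_mem_pureStates (by simp [stdVec])))
  choose u hu1 hu using hex
  have hort : ∀ i j, star (u i) ⬝ᵥ u j = if i = j then 1 else 0 := by
    intro i j
    split_ifs with h
    · rw [h, hu1]
    · rw [← Complex.normSq_eq_zero, hF.normSq_dotProduct (hu i) (hu j), star_stdVec_dotProduct]
      simp [stdVec, h]
  let U : Matrix (Fin m) (Fin m) ℂ := Matrix.of fun a i => u i a
  have hU : Uᴴ * U = 1 := by
    ext i j
    rw [Matrix.one_apply, ← hort]
    rfl
  have hUu : ∀ i, Uᴴ *ᵥ u i = stdVec i := fun i => by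
    funext j
    rw [stdVec, Pi.single_apply]
    exact (hort j i).trans rfl
  have hG := hF.conjAfter hU
  have hGE : ∀ i, ProdNumRange.conjAfter U F (ketbra (stdVec i)) = ketbra (stdVec i) := fun i => by
    rw [ketbra_conjAfter U (hu i), hUu]
  obtain ⟨y, hy⟩ := hG.exists_ketbra 1
  have hyn : ∀ i, conj (y i) * y i = 1 := fun i => by
    rw [← Complex.normSq_eq_conj_mul_self, hG.normSq_apply hGE hy]
    simp
  -- Conjugation by `U` has fixed the coordinate projections; the diagonal phases also restore the
  -- all-ones matrix without moving them.
  let D : Matrix (Fin m) (Fin m) ℂ := Matrix.diagonal y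
  have hD : Dᴴ * D = 1 := by
    rw [Matrix.diagonal_conjTranspose, Matrix.diagonal_mul_diagonal, ← Matrix.diagonal_one]
    congr 1
    funext i
    exact hyn i
  have hH := hG.conjAfter hD
  have hHJ : ProdNumRange.conjAfter D (ProdNumRange.conjAfter U F) (ketbra 1) = ketbra 1 := by
    rw [ketbra_conjAfter D hy, Matrix.diagonal_conjTranspose]
    congr 1
    funext i
    rw [Matrix.mulVec_diagonal]
    exact hyn i
  have hHE : ∀ i, ProdNumRange.conjAfter D (ProdNumRange.conjAfter U F) (ketbra (stdVec i)) =
      ketbra (stdVec i) := fun i => by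
    have e : Dᴴ *ᵥ stdVec i = conj (y i) • stdVec i := by
      rw [Matrix.diagonal_conjTranspose]
      funext j
      rw [Matrix.mulVec_diagonal]
      by_cases h : j = i
      · subst h
        rfl
      · simp [stdVec, h]
    rw [ketbra_conjAfter D (hGE i), e, ketbra_smul, Complex.normSq_eq_conj_mul_self,
      Complex.conj_conj, mul_comm, hyn, one_smul]
  have hU' : U * Uᴴ = 1 := mul_eq_one_comm.mp hU
  have hD' : D * Dᴴ = 1 := mul_eq_one_comm.mp hD
  have hback : ∀ A, F A = U * D * ProdNumRange.conjAfter D (ProdNumRange.conjAfter U F) A *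
      (U * D)ᴴ := fun A => by
    rw [conjAfter_apply, conjAfter_apply, Matrix.conjTranspose_mul,
      show U * D * (Dᴴ * (Uᴴ * F A * U) * D) * (Dᴴ * Uᴴ) =
        U * (D * Dᴴ) * Uᴴ * F A * (U * (D * Dᴴ) * Uᴴ) by simp only [mul_assoc], hD', mul_one, hU',
      one_mul, mul_one]
  refine ⟨U * D, ?_, ?_⟩
  · rw [Matrix.mem_unitaryGroup_iff', Matrix.star_eq_conjTranspose, Matrix.conjTranspose_mul,
      show Dᴴ * Uᴴ * (U * D) = Dᴴ * (Uᴴ * U) * D by simp only [mul_assoc], hU, mul_one, hD]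
  · rcases hH.eq_id_or_transpose hHE hHJ with h | h
    · exact Or.inl fun A => by rw [← h A, ← hback, h]
    · exact Or.inr fun A => by rw [← h A, ← hback]

end Preserver

/-! ### Recovering the factor maps by partial traces. -/

section Assembly

variable {m n : ℕ}

/-- The partial trace over the second factor, as a linear map. -/
def traceRight (m n : ℕ) :
    Matrix (Fin m × Fin n) (Fin m × Fin n) ℂ →ₗ[ℂ] Matrix (Fin m) (Fin m) ℂ where
  toFun X := Matrix.of fun i j => ∑ k, X (i, k) (j, k)
  map_add' X Y := by
    ext i j
    simp [Finset.sum_add_distrib]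
  map_smul' c X := by
    ext i j
    simp [Finset.mul_sum]

theorem traceRight_kronecker (A : Matrix (Fin m) (Fin m) ℂ) (B : Matrix (Fin n) (Fin n) ℂ) :
    traceRight m n (A ⊗ₖ B) = B.trace • A := by
  ext i j
  simp [traceRight, Matrix.trace, ← Finset.mul_sum, mul_comm]

/-- The partial trace over the first factor, as a linear map. -/
def traceLeft (m n : ℕ) :
    Matrix (Fin m × Fin n) (Fin m × Fin n) ℂ →ₗ[ℂ] Matrix (Fin n) (Fin n) ℂ where
  toFun X := Matrix.of fun i j => ∑ k, X (k, i) (k, j)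
  map_add' X Y := by
    ext i j
    simp [Finset.sum_add_distrib]
  map_smul' c X := by
    ext i j
    simp [Finset.mul_sum]

theorem traceLeft_kronecker (A : Matrix (Fin m) (Fin m) ℂ) (B : Matrix (Fin n) (Fin n) ℂ) :
    traceLeft m n (A ⊗ₖ B) = A.trace • B := by
  ext i j
  simp [traceLeft, Matrix.trace, ← Finset.sum_mul]

/-- A linear extension of a surjection between sets of pure states comes from a unitary. -/
theorem exists_isConjForm_of_surjective {f : pureStates m → pureStates m}
    (hf : Function.Surjective f) {F : Matrix (Fin m) (Fin m) ℂ →ₗ[ℂ] Matrix (Fin m) (Fin m) ℂ}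
    (hF : ∀ P, F P.1 = (f P).1) : ∃ U ∈ Matrix.unitaryGroup (Fin m) ℂ, IsConjForm U F := by
  refine (preservesPure_of_surjOn (fun P hP => ?_) fun R hR => ?_).exists_isConjForm
  · rw [hF ⟨P, hP⟩]
    exact (f ⟨P, hP⟩).2
  · obtain ⟨P, hP⟩ := hf ⟨R, hR⟩
    exact ⟨P.1, P.2, by rw [hF, hP]⟩

theorem card_le_of_surjective {f : pureStates m → pureStates n}
    (hf : Function.Surjective f) {F : Matrix (Fin m) (Fin m) ℂ →ₗ[ℂ] Matrix (Fin n) (Fin n) ℂ}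
    (hF : ∀ P, F P.1 = (f P).1) : n ≤ m := by
  refine card_le_of_surjOn_pureStates (F := F) (fun P hP => ?_) fun R hR => ?_
  · rw [hF ⟨P, hP⟩]
    exact (f ⟨P, hP⟩).2
  · obtain ⟨P, hP⟩ := hf ⟨R, hR⟩
    exact ⟨P.1, P.2, by rw [hF, hP]⟩

/-- Freezing one factor at a pure state and tracing out its image, of trace one, extends each factor
map linearly. -/
theorem hasNaturalForm_of_image (hm : 2 ≤ m) (hn : 2 ≤ n)
    {Ψ : Matrix (Fin m × Fin n) (Fin m × Fin n) ℂ →ₗ[ℂ] Matrix (Fin m × Fin n) (Fin m × Fin n) ℂ}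
    (hinj : Function.Injective Ψ) (hΨ : ∀ X, Ψ X ∈ sepPureStates m n ↔ X ∈ sepPureStates m n) :
    HasNaturalForm Ψ := by
  obtain ⟨P₀, -⟩ := exists_three_pureStates hm
  obtain ⟨Q₀, -⟩ := exists_three_pureStates hn
  rcases exists_factor_maps hm hn hinj hΨ with ⟨f, g, hf, hg, h⟩ | ⟨f, g, hf, hg, h⟩
  · let F := traceRight m n ∘ₗ Ψ ∘ₗ (kron m n).flip Q₀.1
    let G := traceLeft m n ∘ₗ Ψ ∘ₗ kron m n P₀.1
    have hF : ∀ P, F P.1 = (f P).1 := fun P => by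
      simp [F, h, traceRight_kronecker, (g Q₀).2.2.2]
    have hG : ∀ Q, G Q.1 = (g Q).1 := fun Q => by
      simp [G, h, traceLeft_kronecker, (f P₀).2.2.2]
    obtain ⟨U, hU, hUF⟩ := exists_isConjForm_of_surjective hf hF
    obtain ⟨V, hV, hVG⟩ := exists_isConjForm_of_surjective hg hG
    have hall : (kron m n).compr₂ Ψ = (kron m n).compl₁₂ F G := bilinear_ext_pure
      fun P hP Q hQ => by simp [h ⟨P, hP⟩ ⟨Q, hQ⟩, hF ⟨P, hP⟩, hG ⟨Q, hQ⟩]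
    exact ⟨U, hU, V, hV, F, G, hUF, hVG, Or.inl fun A B _ _ => LinearMap.congr_fun₂ hall A B⟩
  · let F := traceLeft m n ∘ₗ Ψ ∘ₗ (kron m n).flip Q₀.1
    let G := traceRight m n ∘ₗ Ψ ∘ₗ kron m n P₀.1
    have hF : ∀ P, F P.1 = (f P).1 := fun P => by
      simp [F, h, traceLeft_kronecker, (g Q₀).2.2.2]
    have hG : ∀ Q, G Q.1 = (g Q).1 := fun Q => by
      simp [G, h, traceRight_kronecker, (f P₀).2.2.2]
    -- The exchanged factor maps are surjective in both directions, so neither dimension exceeds the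
    -- other.
    obtain rfl : m = n := le_antisymm (card_le_of_surjective hg hG) (card_le_of_surjective hf hF)
    obtain ⟨U, hU, hUF⟩ := exists_isConjForm_of_surjective hf hF
    obtain ⟨V, hV, hVG⟩ := exists_isConjForm_of_surjective hg hG
    have hall : (kron m m).compr₂ Ψ = ((kron m m).compl₁₂ G F).flip := bilinear_ext_pure
      fun P hP Q hQ => by simp [h ⟨P, hP⟩ ⟨Q, hQ⟩, hF ⟨P, hP⟩, hG ⟨Q, hQ⟩]
    exact ⟨U, hU, V, hV, F, G, hUF, hVG, Or.inr ⟨rfl, fun A B _ _ => by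
      simpa using LinearMap.congr_fun₂ hall A B⟩⟩

end Assembly

end ProdNumRange

theorem theorem4p1 (m n : ℕ) (hm : 2 ≤ m) (hn : 2 ≤ n)
    (Ψ : Matrix (Fin m × Fin n) (Fin m × Fin n) ℂ →ₗ[ℂ]
      Matrix (Fin m × Fin n) (Fin m × Fin n) ℂ) :
    List.TFAE
      [∀ T, ProdNumRange.prodNumRange (ProdNumRange.dualMap Ψ T) = ProdNumRange.prodNumRange T,
       ∀ T, convexHull ℝ (ProdNumRange.prodNumRange (ProdNumRange.dualMap Ψ T)) =
          convexHull ℝ (ProdNumRange.prodNumRange T),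
       ProdNumRange.HasNaturalForm Ψ] := by
  tfae_have 1 → 2 := fun h T => by rw [h]
  tfae_have 2 → 3 := fun h =>
    ProdNumRange.hasNaturalForm_of_image hm hn (ProdNumRange.image_sepPureStates h).1
      (ProdNumRange.image_sepPureStates h).2
  tfae_have 3 → 1 := fun h => h.prodNumRange_dualMap
  tfae_finish
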